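/- Let $(M,g,J)$ be a Kähler surface: a smooth (Hausdorff, second countable) manifold of real dimension $4$ with an integrable almost complex structure $J$ and a Riemannian metric $g=\langle\cdot,\cdot\rangle$ such that $\langle JX,JY\rangle=\langle X,Y\rangle$ and the Kähler form $\omega(X,Y)=\langle JX,Y\rangle$ is closed. Let $p\in\mathbb Z$, let $\pi:\overline M_p\to M$ be a smooth principal circle bundle, and let $\bar\eta$ be a connection on it (a real-valued smooth $1$-form, invariant under the circle action and equal to a nonzero constant on the vector field generating the action) whose curvature is $d\bar\eta=p\,\pi^*\omega$, where the exterior derivative is normalized by $$d\bar\eta(\overline X,\overline Y)=\tfrac12\bigl(\overline X\,\bar\eta(\overline Y)-\overline Y\,\bar\eta(\overline X)-\bar\eta([\overline X,\overline Y])\bigr).$$ Let $\bar\xi$ be the vertical vector field with $\bar\eta(\bar\xi)=1$, and give $\overline M_p$ the Riemannian metric $\bar g=\pi^*g+\bar\eta\otimes\bar\eta$. For a vector field $X$ on $M$ let $X^L$ be its horizontal lift, i.e. the vector field on $\overline M_p$ with $\pi_*X^L=X$ and $\bar\eta(X^L)=0$. Let $R$ and $\overline R$ be the curvature tensors of the Levi-Civita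 connections $\nabla$ of $g$ and $\overline\nabla$ of $\bar g$, with the convention $R(X,Y)Z=\nabla_X\nabla_YZ-\nabla_Y\nabla_XZ-\nabla_{[X,Y]}Z$. Then for all smooth vector fields $X,Y,Z,W$ on $M$, at every point of $\overline M_p$ (the functions on the right being evaluated at its image in $M$), $$\bar g(\overline R(X^L,Y^L)Z^L,W^L)=\langle R(X,Y)Z,W\rangle+p^2\bigl[-\langle JY,Z\rangle\langle JX,W\rangle+\langle JX,Z\rangle\langle JY,W\rangle+2\langle JX,Y\rangle\langle JZ,W\rangle\bigr],$$ $$\bar g(\overline R(X^L,Y^L)Z^L,\bar\xi)=0,\qquad \bar g(\overline R(\bar\xi,X^L)Y^L,\bar\xi)=p^2\langle X,Y\rangle.$$ -/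

import Mathlib

open Bundle VectorField
open scoped Manifold ContDiff

noncomputable section

namespace KahlerCircle

section General

variable {E : Type*} [NormedAddCommGroup E] [NormedSpace ℝ E]
  {H : Type*} [TopologicalSpace H] (I : ModelWithCorners ℝ E H)
  {N : Type*} [TopologicalSpace N] [ChartedSpace H N]

/-- Smooth vector fields. -/
def IsSmoothField [IsManifold I ∞ N] (X : Π x : N, TangentSpace I x) : Prop :=
  ContMDiff I I.tangent ∞ (fun x => (⟨x, X x⟩ : TangentBundle I N))

/-- The derivative `X f` of a function along a vector field. -/
def dirDeriv (X : Π x : N, TangentSpace I x) (f : N → ℝ) (x : N) : ℝ :=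
  mvfderiv I f x (X x)

/-- Exterior derivative of a 1-form, evaluated on vector fields, in the normalization
`dη(X,Y) = (1/2) (X η(Y) - Y η(X) - η([X,Y]))`. -/
def extDerivOneForm (η : Π x : N, TangentSpace I x →L[ℝ] ℝ) (X Y : Π x : N, TangentSpace I x)
    (x : N) : ℝ :=
  (1 / 2) * (dirDeriv I X (fun y => η y (Y y)) x - dirDeriv I Y (fun y => η y (X y)) x
    - η x (mlieBracket I X Y x))

/-- The sum `X σ(Y,Z) - Y σ(X,Z) + Z σ(X,Y) - σ([X,Y],Z) + σ([X,Z],Y) - σ([Y,Z],X)`, which is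
the exterior derivative of a 2-form `σ` up to a universal nonzero factor. -/
def cartanTwoForm (σ : Π x : N, TangentSpace I x → TangentSpace I x → ℝ)
    (X Y Z : Π x : N, TangentSpace I x) (x : N) : ℝ :=
  dirDeriv I X (fun y => σ y (Y y) (Z y)) x - dirDeriv I Y (fun y => σ y (X y) (Z y)) x
    + dirDeriv I Z (fun y => σ y (X y) (Y y)) x
    - σ x (mlieBracket I X Y x) (Z x) + σ x (mlieBracket I X Z x) (Y x)
    - σ x (mlieBracket I Y Z x) (X x)

/-- The Nijenhuis tensor `[JX,JY] - J[JX,Y] - J[X,JY] - [X,Y]` of an almost complex structure. -/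
def nijenhuis (J : Π x : N, TangentSpace I x →L[ℝ] TangentSpace I x)
    (X Y : Π x : N, TangentSpace I x) (x : N) : TangentSpace I x :=
  mlieBracket I (fun y => J y (X y)) (fun y => J y (Y y)) x
    - J x (mlieBracket I (fun y => J y (X y)) Y x)
    - J x (mlieBracket I X (fun y => J y (Y y)) x)
    - mlieBracket I X Y x

/-- `D` is the Levi-Civita connection of `g`: a smooth connection on the tangent bundle which is
torsion-free and satisfies `X g(Y,Z) = g(∇_X Y, Z) + g(Y, ∇_X Z)`. In Mathlib's notation
`(∇_X Y)(x)` is `D Y x (X x)`. -/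
structure IsLeviCivita [FiniteDimensional ℝ E] [IsManifold I ∞ N]
    (g : Π x : N, TangentSpace I x → TangentSpace I x → ℝ)
    (D : CovariantDerivative I E (TangentSpace I : N → Type _)) : Prop where
  smooth : CovariantDerivative.ContMDiffCovariantDerivative D ∞
  torsion_eq_zero : D.torsion = 0
  metric : ∀ X Y Z : Π x : N, TangentSpace I x,
    IsSmoothField I X → IsSmoothField I Y → IsSmoothField I Z →
    ∀ x, dirDeriv I X (fun y => g y (Y y) (Z y)) x
      = g x (D Y x (X x)) (Z x) + g x (Y x) (D Z x (X x))

/-- The curvature `R(X,Y)Z = ∇_X ∇_Y Z - ∇_Y ∇_X Z - ∇_{[X,Y]} Z`. -/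
def curvature [IsManifold I ∞ N] (D : CovariantDerivative I E (TangentSpace I : N → Type _))
    (X Y Z : Π x : N, TangentSpace I x) (x : N) : TangentSpace I x :=
  D (fun y => D Z y (Y y)) x (X x) - D (fun y => D Z y (X y)) x (Y x)
    - D Z x (mlieBracket I X Y x)

end General

/-- A Kähler surface: a 4-manifold with an integrable almost complex structure `J` and a
Riemannian metric for which `J` is orthogonal and whose fundamental form `⟨J·, ·⟩` is closed. -/
structure KahlerSurface (M : Type*) [TopologicalSpace M]
    [ChartedSpace (EuclideanSpace ℝ (Fin 4)) M] [IsManifold (𝓡 4) ∞ M] where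
  metric : ContMDiffRiemannianMetric (𝓡 4) ∞ (EuclideanSpace ℝ (Fin 4))
    (TangentSpace (𝓡 4) : M → Type _)
  J : Π x : M, TangentSpace (𝓡 4) x →L[ℝ] TangentSpace (𝓡 4) x
  J_smooth : ContMDiff (𝓡 4)
    ((𝓡 4).prod 𝓘(ℝ, EuclideanSpace ℝ (Fin 4) →L[ℝ] EuclideanSpace ℝ (Fin 4))) ∞
    (fun x => TotalSpace.mk' (EuclideanSpace ℝ (Fin 4) →L[ℝ] EuclideanSpace ℝ (Fin 4))
      (E := fun x : M => TangentSpace (𝓡 4) x →L[ℝ] TangentSpace (𝓡 4) x) x (J x))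
  J_sq : ∀ x (u : TangentSpace (𝓡 4) x), J x (J x u) = -u
  J_orthogonal : ∀ x (u v : TangentSpace (𝓡 4) x),
    metric.inner x (J x u) (J x v) = metric.inner x u v
  J_integrable : ∀ X Y : Π x : M, TangentSpace (𝓡 4) x,
    IsSmoothField (𝓡 4) X → IsSmoothField (𝓡 4) Y → ∀ x, nijenhuis (𝓡 4) J X Y x = 0
  closed : ∀ X Y Z : Π x : M, TangentSpace (𝓡 4) x,
    IsSmoothField (𝓡 4) X → IsSmoothField (𝓡 4) Y → IsSmoothField (𝓡 4) Z →
    ∀ x, cartanTwoForm (𝓡 4) (fun y u v => metric.inner y (J y u) v) X Y Z x = 0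

namespace KahlerSurface

variable {M : Type*} [TopologicalSpace M]
    [ChartedSpace (EuclideanSpace ℝ (Fin 4)) M] [IsManifold (𝓡 4) ∞ M] (K : KahlerSurface M)

/-- The metric `⟨u, v⟩`. -/
def g (x : M) (u v : TangentSpace (𝓡 4) x) : ℝ := K.metric.inner x u v

/-- The Kähler form `⟨Ju, v⟩`. -/
def kahlerForm (x : M) (u v : TangentSpace (𝓡 4) x) : ℝ := K.g x (K.J x u) v

end KahlerSurface

/-- A smooth principal circle bundle `Mbar → M` over a 4-manifold: a smooth circle action on the
total space, together with equivariant smooth local trivializations over `M`. -/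
structure CircleBundle (M Mbar : Type*) [TopologicalSpace M]
    [ChartedSpace (EuclideanSpace ℝ (Fin 4)) M] [IsManifold (𝓡 4) ∞ M]
    [TopologicalSpace Mbar] [ChartedSpace (EuclideanSpace ℝ (Fin 5)) Mbar]
    [IsManifold (𝓡 5) ∞ Mbar] [MulAction Circle Mbar] where
  proj : Mbar → M
  smooth_proj : ContMDiff (𝓡 5) (𝓡 4) ∞ proj
  smooth_action : ContMDiff ((𝓡 1).prod (𝓡 5)) (𝓡 5) ∞ (fun q : Circle × Mbar => q.1 • q.2)
  proj_smul : ∀ (z : Circle) (x : Mbar), proj (z • x) = proj x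
  local_triv : ∀ m : M, ∃ (U : Set M) (φ : OpenPartialHomeomorph Mbar (M × Circle)),
    IsOpen U ∧ m ∈ U ∧ φ.source = proj ⁻¹' U ∧ φ.target = U ×ˢ Set.univ ∧
    ContMDiffOn (𝓡 5) ((𝓡 4).prod (𝓡 1)) ∞ φ φ.source ∧
    ContMDiffOn ((𝓡 4).prod (𝓡 1)) (𝓡 5) ∞ φ.symm φ.target ∧
    (∀ x ∈ φ.source, (φ x).1 = proj x) ∧
    ∀ (z : Circle), ∀ x ∈ φ.source, φ (z • x) = ((φ x).1, z * (φ x).2)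

namespace CircleBundle

variable {M Mbar : Type*} [TopologicalSpace M]
    [ChartedSpace (EuclideanSpace ℝ (Fin 4)) M] [IsManifold (𝓡 4) ∞ M]
    [TopologicalSpace Mbar] [ChartedSpace (EuclideanSpace ℝ (Fin 5)) Mbar]
    [IsManifold (𝓡 5) ∞ Mbar] [MulAction Circle Mbar] (P : CircleBundle M Mbar)

/-- The differential of the projection. -/
def dproj (x : Mbar) : TangentSpace (𝓡 5) x →L[ℝ] TangentSpace (𝓡 4) (P.proj x) :=
  mfderiv (𝓡 5) (𝓡 4) P.proj x

/-- The generator of the circle action: the velocity at `t = 0` of `t ↦ exp(it) • x`. -/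
def generator (_ : CircleBundle M Mbar) (x : Mbar) : TangentSpace (𝓡 5) x :=
  mfderiv 𝓘(ℝ, ℝ) (𝓡 5) (fun t : ℝ => Circle.exp t • x) 0 (1 : ℝ)

theorem dproj_surjective (x : Mbar) : Function.Surjective (P.dproj x) := by
  obtain ⟨U, φ, hU, hm, hs, ht, -, hφ', hpr, -⟩ := P.local_triv (P.proj x)
  have hx : x ∈ φ.source := by rw [hs]; exact hm
  set w := (φ x).2 with hw
  have hφx : φ x = (P.proj x, w) := Prod.ext (hpr x hx) rfl
  have hmem : (P.proj x, w) ∈ φ.target := by rw [← hφx]; exact φ.map_source hx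
  have hback : φ.symm (P.proj x, w) = x := by rw [← hφx]; exact φ.left_inv hx
  have h1 : MDifferentiableAt (𝓡 4) ((𝓡 4).prod (𝓡 1)) (fun y : M => (y, w)) (P.proj x) :=
    mdifferentiableAt_id.prodMk mdifferentiableAt_const
  have h2 : MDifferentiableAt ((𝓡 4).prod (𝓡 1)) (𝓡 5) φ.symm (P.proj x, w) :=
    ((hφ' _ hmem).contMDiffAt (φ.open_target.mem_nhds hmem)).mdifferentiableAt (by simp)
  have h12 : MDifferentiableAt (𝓡 4) (𝓡 5) (fun y : M => φ.symm (y, w)) (P.proj x) :=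
    h2.comp (P.proj x) h1
  have h3 : MDifferentiableAt (𝓡 5) (𝓡 4) P.proj (φ.symm (P.proj x, w)) :=
    (P.smooth_proj _).mdifferentiableAt (by simp)
  have hev : (P.proj ∘ fun y : M => φ.symm (y, w)) =ᶠ[nhds (P.proj x)] id := by
    filter_upwards [hU.mem_nhds hm] with y hy
    have hyt : (y, w) ∈ φ.target := by rw [ht]; exact ⟨hy, trivial⟩
    have := hpr _ (φ.map_target hyt)
    rw [φ.right_inv hyt] at this
    exact this.symm
  have hcomp := mfderiv_comp (P.proj x) h3 h12
  rw [hev.mfderiv_eq, mfderiv_id] at hcomp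
  intro v
  refine ⟨mfderiv (𝓡 4) (𝓡 5) (fun y : M => φ.symm (y, w)) (P.proj x) v, ?_⟩
  have := congrArg (fun L => L v) hcomp
  unfold dproj
  rw [hback] at this
  exact this.symm

theorem dproj_generator (x : Mbar) : P.dproj x (P.generator x) = 0 := by
  have h1 : MDifferentiableAt 𝓘(ℝ, ℝ) (𝓡 5) (fun t : ℝ => Circle.exp t • x) 0 := by
    have h : ContMDiff 𝓘(ℝ, ℝ) (𝓡 5) ∞ (fun t : ℝ => Circle.exp t • x) :=
      P.smooth_action.comp (contMDiff_circleExp.prodMk contMDiff_const)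
    exact (h 0).mdifferentiableAt (by simp)
  have h3 : MDifferentiableAt (𝓡 5) (𝓡 4) P.proj (Circle.exp 0 • x) :=
    (P.smooth_proj _).mdifferentiableAt (by simp)
  have hcomp := mfderiv_comp (0 : ℝ) h3 h1
  have hc : (P.proj ∘ fun t : ℝ => Circle.exp t • x) = fun _ => P.proj x := by
    funext t; exact P.proj_smul _ _
  rw [hc, mfderiv_const] at hcomp
  have := congrArg (fun L => L (1 : ℝ)) hcomp
  unfold dproj generator
  have h0 : Circle.exp 0 • x = x := by simp
  rw [h0] at this
  exact this.symm

/-- A connection on a principal circle bundle: an invariant smooth 1-form that takes a constant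
nonzero value `scale` on the generator of the action. The value of `scale` amounts to the
identification of the Lie algebra of the circle with `ℝ`, which is left free. -/
structure Connection where
  form : Π x : Mbar, TangentSpace (𝓡 5) x →L[ℝ] ℝ
  smooth : ContMDiff (𝓡 5) ((𝓡 5).prod 𝓘(ℝ, EuclideanSpace ℝ (Fin 5) →L[ℝ] ℝ)) ∞
    (fun x => TotalSpace.mk' (EuclideanSpace ℝ (Fin 5) →L[ℝ] ℝ)
      (E := fun x : Mbar => TangentSpace (𝓡 5) x →L[ℝ] Bundle.Trivial Mbar ℝ x) x (form x))
  invariant : ∀ (z : Circle) (x : Mbar) (u : TangentSpace (𝓡 5) x),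
    form (z • x) (mfderiv (𝓡 5) (𝓡 5) (fun y : Mbar => z • y) x u) = form x u
  scale : ℝ
  scale_ne_zero : scale ≠ 0
  form_generator : ∀ x, form x (P.generator x) = scale

namespace Connection

variable {P} (A : P.Connection)

/-- The vertical vector field `ξ` with `η(ξ) = 1`. -/
def xi (x : Mbar) : TangentSpace (𝓡 5) x := A.scale⁻¹ • P.generator x

theorem form_xi (x : Mbar) : A.form x (A.xi x) = 1 := by
  simp [xi, A.form_generator, A.scale_ne_zero]

theorem dproj_xi (x : Mbar) : P.dproj x (A.xi x) = 0 := by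
  simp [xi, P.dproj_generator]

/-- The connection has curvature `dη = p ω`, i.e. `dη(X,Y) = p ω(π_* X, π_* Y)`. -/
def HasCurvature (p : ℤ) (K : KahlerSurface M) : Prop :=
  ∀ X Y : Π x : Mbar, TangentSpace (𝓡 5) x, IsSmoothField (𝓡 5) X → IsSmoothField (𝓡 5) Y →
    ∀ x, extDerivOneForm (𝓡 5) A.form X Y x
      = p * K.kahlerForm (P.proj x) (P.dproj x (X x)) (P.dproj x (Y x))

/-- The metric `π^* g + η ⊗ η` on the total space. -/
def gbar (K : KahlerSurface M) (x : Mbar) (u v : TangentSpace (𝓡 5) x) : ℝ :=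
  K.g (P.proj x) (P.dproj x u) (P.dproj x v) + A.form x u * A.form x v

theorem existsUnique_horizontal (x : Mbar) (v : TangentSpace (𝓡 4) (P.proj x)) :
    ∃! u : TangentSpace (𝓡 5) x, P.dproj x u = v ∧ A.form x u = 0 := by
  let L : EuclideanSpace ℝ (Fin 5) →ₗ[ℝ] EuclideanSpace ℝ (Fin 4) × ℝ :=
    LinearMap.prod (P.dproj x : TangentSpace (𝓡 5) x →ₗ[ℝ] TangentSpace (𝓡 4) (P.proj x))
      (A.form x : TangentSpace (𝓡 5) x →ₗ[ℝ] ℝ)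
  have hL : ∀ u : TangentSpace (𝓡 5) x, L u = (P.dproj x u, A.form x u) := fun _ => rfl
  have hsurj : Function.Surjective L := by
    rintro ⟨w, c⟩
    obtain ⟨u, hu⟩ := P.dproj_surjective x w
    let u' : TangentSpace (𝓡 5) x := u + (c - A.form x u) • A.xi x
    refine ⟨u', ?_⟩
    rw [hL u']
    refine Prod.ext ?_ ?_
    · simp only [u', map_add, map_smul, A.dproj_xi, smul_zero, hu]
      exact add_zero w
    · simp [u', A.form_xi]
  have hinj : Function.Injective L :=
    (LinearMap.injective_iff_surjective_of_finrank_eq_finrank (by simp)).2 hsurj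
  obtain ⟨u, hu⟩ := hsurj (v, 0)
  refine ⟨u, ⟨congrArg Prod.fst hu, congrArg Prod.snd hu⟩, fun u' hu' => hinj ?_⟩
  exact (Prod.ext hu'.1 hu'.2 : L u' = (v, 0)).trans hu.symm

/-- The horizontal lift `X^L`: the vector field with `π_* X^L = X` and `η(X^L) = 0`. -/
def lift (X : Π m : M, TangentSpace (𝓡 4) m) (x : Mbar) : TangentSpace (𝓡 5) x :=
  (A.existsUnique_horizontal x (X (P.proj x))).choose

theorem dproj_lift (X : Π m : M, TangentSpace (𝓡 4) m) (x : Mbar) :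
    P.dproj x (A.lift X x) = X (P.proj x) :=
  (A.existsUnique_horizontal x (X (P.proj x))).choose_spec.1.1

theorem form_lift (X : Π m : M, TangentSpace (𝓡 4) m) (x : Mbar) :
    A.form x (A.lift X x) = 0 :=
  (A.existsUnique_horizontal x (X (P.proj x))).choose_spec.1.2

end Connection
end CircleBundle
end KahlerCircle
end

noncomputable section

namespace KahlerCircle

/-! ### Lie brackets in charts and under related vector fields -/

section Bracket

open Set Filter Topology

variable {E : Type*} [NormedAddCommGroup E] [NormedSpace ℝ E]
  {H : Type*} [TopologicalSpace H] {I : ModelWithCorners ℝ E H}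
  {N : Type*} [TopologicalSpace N] [ChartedSpace H N]
  {F : Type*} [NormedAddCommGroup F] [NormedSpace ℝ F]

/-! The projection is a Riemannian submersion whose fibres are tangent to the unit field ξ, so the
curvature follows once the connection upstairs is known on lifts and on ξ. A tangent vector upstairs
is determined by its projection and its value under η (`eq_of_dproj_form`), and every identity is
checked on these two components.

Brackets of π-related fields are π-related, and dη = pω supplies the η-component, so [X^L,Y^L] =
[X,Y]^L − 2pω(X,Y)ξ and [ξ,X^L] = 0. The Koszul formula, together with metric compatibility and zero
torsion, then gives ∇̄_{X^L} Y^L = (∇_X Y)^L − pω(X,Y)ξ (`nabla_lift_lift`) and ∇̄_{X^L} ξ = ∇̄_ξ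
X^L = p(JX)^L (`nabla_lift_xi`, `nabla_xi_lift`).

Substitution into the curvature yields the three quadratic terms in J as its horizontal part
(`dproj_curvature_lift`). The vertical part is −p⟨∇_X(JY) − ∇_Y(JX) − J[X,Y], Z⟩, which vanishes
because J is parallel (`nablaJ_eq_zero`); that in turn follows from dω = 0 and the vanishing of the
Nijenhuis tensor. In the ξ-sectional term only −∇̄_{X^L}∇̄_ξ Y^L has a vertical component, and
orthogonality of J makes it p²⟨X,Y⟩ (`form_curvature_xi`). -/

theorem contDiffAt_comp_extChartAt_symm [I.Boundaryless] {f : N → F} {x : N}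
    (hf : ContMDiffAt I 𝓘(ℝ, F) ∞ f x) :
    ContDiffAt ℝ ∞ (f ∘ (extChartAt I x).symm) (extChartAt I x x) := by
  have h := (contMDiffAt_iff.1 hf).2
  rw [I.range_eq_univ, contDiffWithinAt_univ] at h
  exact h

variable [IsManifold I ∞ N]

/-- A vector field read in the chart at `x`. -/
def chartField (V : Π x : N, TangentSpace I x) (x : N) : E → E :=
  mpullbackWithin 𝓘(ℝ, E) I (extChartAt I x).symm V (range I)

theorem chartField_self (V : Π x : N, TangentSpace I x) (x : N) :
    chartField V x (extChartAt I x x) = V x := by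
  have h := mfderivWithin_extChartAt_symm_inverse_apply (I := I) (x := x)
    (V ((extChartAt I x).symm (extChartAt I x x)))
  have h2 : (V ((extChartAt I x).symm (extChartAt I x x)) : E) = V x := by
    rw [extChartAt_to_inv]
  exact Eq.trans h h2

/-- The preferred chart at `x` has identity differential at `x` itself, so no coordinate change
appears. -/
theorem mvfderiv_eq_fderiv_chart {f : N → F} {x : N} {h : E → F}
    (hh : DifferentiableAt ℝ h (extChartAt I x x)) (hfh : f =ᶠ[𝓝 x] h ∘ extChartAt I x)
    (v : TangentSpace I x) : mvfderiv I f x v = fderiv ℝ h (extChartAt I x x) v := by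
  have h1 : mfderiv I 𝓘(ℝ, F) f x = mfderiv I 𝓘(ℝ, F) (h ∘ extChartAt I x) x := hfh.mfderiv_eq
  have h2 := mfderiv_comp x hh.mdifferentiableAt
    (mdifferentiableAt_extChartAt (I := I) (mem_chart_source H x))
  rw [mfderiv_extChartAt_self, mfderiv_eq_fderiv] at h2
  have h3 : mfderiv I 𝓘(ℝ, F) f x v = fderiv ℝ h (extChartAt I x x) v := by
    have := h1.trans ((hfh.eq_of_nhds ▸ rfl : _ = _).trans h2)
    exact congrArg (fun L : E →L[ℝ] F => L v) this
  exact h3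

variable [I.Boundaryless]

theorem mlieBracket_eq_lieBracket_chartField (V W : Π x : N, TangentSpace I x) (x : N) :
    mlieBracket I V W x
      = lieBracket ℝ (chartField V x) (chartField W x) (extChartAt I x x) := by
  have h : mlieBracket I V W x = (mfderiv I 𝓘(ℝ, E) (extChartAt I x) x).inverse
      (lieBracketWithin (E := E) ℝ (chartField V x) (chartField W x)
        ((extChartAt I x).symm ⁻¹' univ ∩ range I) (extChartAt I x x)) := rfl
  rw [I.range_eq_univ, preimage_univ, inter_univ, lieBracketWithin_univ,
    mfderiv_extChartAt_self] at h
  exact h.trans (congrArg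
    (fun L : E →L[ℝ] E => L (lieBracket (E := E) ℝ (chartField V x) (chartField W x)
      (extChartAt I x x))) (ContinuousLinearMap.inverse_id (R := ℝ) (M := E)))

/-- The field in the chart is the inverse of the differential of the inverse chart applied to `V`;
the chain rule cancels the two. -/
theorem fderiv_chartField {f : N → F} (V : Π x : N, TangentSpace I x) (x : N) {z : E}
    (hz : z ∈ (extChartAt I x).target)
    (hf : MDifferentiableAt I 𝓘(ℝ, F) f ((extChartAt I x).symm z)) :
    fderiv ℝ (f ∘ (extChartAt I x).symm) z (chartField V x z)
      = mvfderiv I f ((extChartAt I x).symm z) (V ((extChartAt I x).symm z)) := by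
  have h1 := mdifferentiableWithinAt_extChartAt_symm (I := I) hz
  have hinv := isInvertible_mfderivWithin_extChartAt_symm (I := I) hz
  rw [← mfderiv_eq_fderiv]
  unfold chartField
  rw [mpullbackWithin_apply]
  rw [I.range_eq_univ, mfderivWithin_univ] at *
  rw [mfderiv_comp z hf (mdifferentiableWithinAt_univ.1 h1)]
  have := hinv.self_apply_inverse (V ((extChartAt I x).symm z))
  exact congrArg (mfderiv I 𝓘(ℝ, F) f ((extChartAt I x).symm z)) this

theorem differentiableAt_chartField [CompleteSpace E] {V : Π x : N, TangentSpace I x} {x : N}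
    (hV : MDifferentiableAt I I.tangent (fun y => (⟨y, V y⟩ : TangentBundle I N)) x) :
    DifferentiableAt ℝ (chartField V x) (extChartAt I x x) := by
  have : IsManifold I 2 N := IsManifold.of_le (n := ∞) ENat.LEInfty.out
  have h := (mdifferentiableWithinAt_univ.2 hV
    ).differentiableWithinAt_mpullbackWithin_vectorField
  have hs : (extChartAt I x).symm ⁻¹' univ ∩ range I = univ := by
    rw [preimage_univ, univ_inter, I.range_eq_univ]
  exact differentiableWithinAt_univ.1 (hs ▸ h)

/-- The derivative of a function along a vector field, read in a chart. -/
theorem mvfderiv_apply_eventuallyEq {f : N → F} {x : N} (hf : ContMDiffAt I 𝓘(ℝ, F) ∞ f x)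
    (U : Π x : N, TangentSpace I x) :
    (fun y => mvfderiv I f y (U y)) =ᶠ[𝓝 x]
      (fun z => fderiv ℝ (f ∘ (extChartAt I x).symm) z (chartField U x z)) ∘ extChartAt I x := by
  set φ := extChartAt I x with hφ
  have h1 : ∀ᶠ y in 𝓝 x, MDifferentiableAt I 𝓘(ℝ, F) f y := by
    have h := (contMDiffAt_iff_contMDiffAt_nhds (n := 1) (by simp)).1
      (hf.of_le (by exact_mod_cast le_top))
    filter_upwards [h] with y hy using hy.mdifferentiableAt one_ne_zero
  filter_upwards [h1, extChartAt_source_mem_nhds (I := I) x] with y hy hys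
  have h := fderiv_chartField U x (φ.map_source hys) (by rwa [← hφ, φ.left_inv hys])
  rw [← hφ, φ.left_inv hys] at h
  exact h.symm

theorem differentiableAt_fderiv_chartField [CompleteSpace E] {f : N → F} {x : N}
    (hf : ContMDiffAt I 𝓘(ℝ, F) ∞ f x) {V : Π x : N, TangentSpace I x}
    (hV : MDifferentiableAt I I.tangent (fun y => (⟨y, V y⟩ : TangentBundle I N)) x) :
    DifferentiableAt ℝ (fun z => fderiv ℝ (f ∘ (extChartAt I x).symm) z (chartField V x z))
      (extChartAt I x x) :=
  (((contDiffAt_comp_extChartAt_symm hf).fderiv_right (m := 1)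
    (one_add_one_eq_two.trans_le ENat.LEInfty.out)).differentiableAt one_ne_zero).clm_apply
    (differentiableAt_chartField hV)

theorem mdifferentiableAt_mvfderiv_apply [CompleteSpace E] {f : N → F} {x : N}
    (hf : ContMDiffAt I 𝓘(ℝ, F) ∞ f x) {V : Π x : N, TangentSpace I x}
    (hV : MDifferentiableAt I I.tangent (fun y => (⟨y, V y⟩ : TangentBundle I N)) x) :
    MDifferentiableAt I 𝓘(ℝ, F) (fun y => mvfderiv I f y (V y)) x :=
  ((differentiableAt_fderiv_chartField hf hV).mdifferentiableAt.comp x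
    (mdifferentiableAt_extChartAt (mem_chart_source H x))).congr_of_eventuallyEq
    (mvfderiv_apply_eventuallyEq hf V)

/-- The bracket acts on functions as the commutator. -/
theorem mvfderiv_mlieBracket [CompleteSpace E] {f : N → F} {V W : Π x : N, TangentSpace I x}
    {x : N} (hf : ContMDiffAt I 𝓘(ℝ, F) ∞ f x)
    (hV : MDifferentiableAt I I.tangent (fun y => (⟨y, V y⟩ : TangentBundle I N)) x)
    (hW : MDifferentiableAt I I.tangent (fun y => (⟨y, W y⟩ : TangentBundle I N)) x) :
    mvfderiv I f x (mlieBracket I V W x)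
      = mvfderiv I (fun y => mvfderiv I f y (W y)) x (V x)
        - mvfderiv I (fun y => mvfderiv I f y (V y)) x (W x) := by
  -- In the chart this is the vector-space identity for the bracket, which rests on symmetry of the
  -- second derivative.
  have hfφ := contDiffAt_comp_extChartAt_symm hf
  rw [mvfderiv_eq_fderiv_chart (differentiableAt_fderiv_chartField hf hW)
      (mvfderiv_apply_eventuallyEq hf W),
    mvfderiv_eq_fderiv_chart (differentiableAt_fderiv_chartField hf hV)
      (mvfderiv_apply_eventuallyEq hf V),
    mvfderiv_eq_fderiv_chart (h := f ∘ (extChartAt I x).symm) (hfφ.differentiableAt (by simp)) ?_,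
    mlieBracket_eq_lieBracket_chartField,
    fderiv_apply_lieBracket (hfφ.of_le (m := 2) ENat.LEInfty.out) (by simp)
      (differentiableAt_chartField hW) (differentiableAt_chartField hV),
    chartField_self, chartField_self]
  filter_upwards [extChartAt_source_mem_nhds (I := I) x] with y hy
  exact congrArg f ((extChartAt I x).left_inv hy).symm

variable {E' : Type*} [NormedAddCommGroup E'] [NormedSpace ℝ E'] [CompleteSpace E']
  {H' : Type*} [TopologicalSpace H'] {I' : ModelWithCorners ℝ E' H'} [I'.Boundaryless]
  {N' : Type*} [TopologicalSpace N'] [ChartedSpace H' N'] [IsManifold I' ∞ N']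

/-- Brackets of related vector fields are related. -/
theorem mfderiv_mlieBracket_of_related [CompleteSpace E] {f : N → N'}
    {V W : Π x : N, TangentSpace I x} {V' W' : Π x : N', TangentSpace I' x} {x : N}
    (hf : ContMDiff I I' ∞ f)
    (hV : MDifferentiableAt I I.tangent (fun y => (⟨y, V y⟩ : TangentBundle I N)) x)
    (hW : MDifferentiableAt I I.tangent (fun y => (⟨y, W y⟩ : TangentBundle I N)) x)
    (hV' : MDifferentiableAt I' I'.tangent (fun y => (⟨y, V' y⟩ : TangentBundle I' N')) (f x))
    (hW' : MDifferentiableAt I' I'.tangent (fun y => (⟨y, W' y⟩ : TangentBundle I' N')) (f x))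
    (hVV' : ∀ y, mfderiv I I' f y (V y) = V' (f y))
    (hWW' : ∀ y, mfderiv I I' f y (W y) = W' (f y)) :
    mfderiv I I' f x (mlieBracket I V W x) = mlieBracket I' V' W' (f x) := by
  -- The map need not be a local diffeomorphism, so the bracket is not pulled back; it is detected
  -- by its action on the vector-valued function ψ, whose differential at `f x` is the identity.
  let ψ : N' → E' := extChartAt I' (f x)
  have hψs : ContMDiffAt I' 𝓘(ℝ, E') ∞ ψ (f x) := contMDiffAt_extChartAt
  have hdf : ∀ y, MDifferentiableAt I I' f y := fun y => (hf y).mdifferentiableAt (by simp)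
  have hψself : ∀ u : TangentSpace I' (f x), mvfderiv I' ψ (f x) u = u := fun u =>
    congrArg (fun L : E' →L[ℝ] E' => L u) (mfderiv_extChartAt_self (I := I') (x := f x))
  have hchain : ∀ (g : N' → E') (y : N) (u : TangentSpace I y),
      MDifferentiableAt I' 𝓘(ℝ, E') g (f y) →
      mvfderiv I (g ∘ f) y u = mvfderiv I' g (f y) (mfderiv I I' f y u) := fun g y u hg =>
    congrArg (fun L : E →L[ℝ] E' => L u) (mfderiv_comp y hg (hdf y))
  -- The chart is differentiable only on its domain, but derivatives at `x` depend only on germs.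
  have hnear : ∀ᶠ y in 𝓝 x, MDifferentiableAt I' 𝓘(ℝ, E') ψ (f y) := by
    filter_upwards [hf.continuous.continuousAt.preimage_mem_nhds
      (chart_source_mem_nhds H' (f x))] with y hy
    exact mdifferentiableAt_extChartAt hy
  have hcomm : ∀ {U : Π x : N, TangentSpace I x} {U' : Π x : N', TangentSpace I' x},
      (∀ y, mfderiv I I' f y (U y) = U' (f y)) →
      (fun y => mvfderiv I (ψ ∘ f) y (U y)) =ᶠ[𝓝 x] (fun m => mvfderiv I' ψ m (U' m)) ∘ f := by
    intro U U' h
    filter_upwards [hnear] with y hy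
    rw [hchain ψ y (U y) hy, h]
    rfl
  have hcong : ∀ {g g' : N → E'}, g =ᶠ[𝓝 x] g' → ∀ u : TangentSpace I x,
      mvfderiv I g x u = mvfderiv I g' x u := fun h u =>
    congrArg (fun L : E →L[ℝ] E' => L u) h.mfderiv_eq
  have h1 := mvfderiv_mlieBracket (hψs.comp x (hf x)) hV hW
  rw [hcong (hcomm hVV'), hcong (hcomm hWW'),
    hchain _ x _ (mdifferentiableAt_mvfderiv_apply hψs hV'),
    hchain _ x _ (mdifferentiableAt_mvfderiv_apply hψs hW'), hVV', hWW',
    ← mvfderiv_mlieBracket hψs hV' hW', hψself,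
    hchain ψ x _ (hψs.mdifferentiableAt (by simp)), hψself] at h1
  exact h1

end Bracket

/-! ### Directional derivatives of functions -/

section DirDeriv

variable {E : Type*} [NormedAddCommGroup E] [NormedSpace ℝ E]
  {H : Type*} [TopologicalSpace H] {I : ModelWithCorners ℝ E H}
  {N : Type*} [TopologicalSpace N] [ChartedSpace H N] (X : Π x : N, TangentSpace I x)

theorem dirDeriv_const (c : ℝ) (x : N) : dirDeriv I X (fun _ => c) x = 0 := by
  simp [dirDeriv, mvfderiv_const]

theorem dirDeriv_neg (f : N → ℝ) (x : N) : dirDeriv I X (-f) x = -dirDeriv I X f x := by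
  unfold dirDeriv
  rw [mvfderiv_neg]
  rfl

theorem dirDeriv_const_mul (c : ℝ) {f : N → ℝ} (hf : ContMDiff I 𝓘(ℝ, ℝ) ∞ f) (x : N) :
    dirDeriv I X (fun y => c * f y) x = c * dirDeriv I X f x := by
  unfold dirDeriv
  have h := mvfderiv_mul (I := I) (x := x) (f := fun _ => c) (g := f) mdifferentiableAt_const
    ((hf x).mdifferentiableAt (by simp))
  rw [mvfderiv_const, smul_zero, add_zero] at h
  exact congrArg (fun L : E →L[ℝ] ℝ => L (X x)) h

end DirDeriv

/-! ### Smooth fields, covariant derivatives and the Koszul formula -/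

section SmoothFields

variable {E : Type*} [NormedAddCommGroup E] [NormedSpace ℝ E]
  {H : Type*} [TopologicalSpace H] {I : ModelWithCorners ℝ E H}
  {N : Type*} [TopologicalSpace N] [ChartedSpace H N] [IsManifold I ∞ N]

namespace IsSmoothField

variable {X Y : Π x : N, TangentSpace I x}

theorem mdifferentiableAt (hX : IsSmoothField I X) (x : N) :
    MDifferentiableAt I I.tangent (fun y => (⟨y, X y⟩ : TangentBundle I N)) x :=
  ContMDiffAt.mdifferentiableAt (hX x) (by simp)

protected theorem zero : IsSmoothField I (0 : Π x : N, TangentSpace I x) :=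
  contMDiff_zeroSection ℝ (TangentSpace I : N → Type _)

protected theorem add (hX : IsSmoothField I X) (hY : IsSmoothField I Y) :
    IsSmoothField I (X + Y) :=
  ContMDiff.add_section hX hY

protected theorem smul {f : N → ℝ} (hf : ContMDiff I 𝓘(ℝ, ℝ) ∞ f) (hX : IsSmoothField I X) :
    IsSmoothField I (f • X) :=
  ContMDiff.smul_section hf hX

protected theorem const_smul (c : ℝ) (hX : IsSmoothField I X) : IsSmoothField I (c • X) :=
  ContMDiff.const_smul_section hX

protected theorem neg (hX : IsSmoothField I X) : IsSmoothField I (-X) := by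
  simpa using hX.const_smul (-1)

end IsSmoothField

/-- Every tangent vector extends to a smooth vector field. -/
theorem exists_isSmoothField [FiniteDimensional ℝ E] [T2Space N] (x : N) (v : TangentSpace I x) :
    ∃ X : Π x : N, TangentSpace I x, IsSmoothField I X ∧ X x = v := by
  have : IsManifold I (∞ + 1) N := inferInstanceAs (IsManifold I ∞ N)
  obtain ⟨s, hs, hsm⟩ := FiberBundle.exists_contMDiffOn_extend (k := ∞) I E v
  obtain ⟨u, hus, hu, hxu⟩ := mem_nhds_iff.1 hs
  -- A bump function supported where the local extension is smooth makes the extension global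
  -- without changing its value at `x`.
  obtain ⟨f, -, hf⟩ := (SmoothBumpFunction.nhds_basis_tsupport (I := I) x).mem_iff.1
    (hu.mem_nhds hxu)
  refine ⟨(f : N → ℝ) • FiberBundle.extend E v, ?_, ?_⟩
  · exact ContMDiffOn.smul_section_of_tsupport f.contMDiff.contMDiffOn hu hf (hsm.mono hus)
  · simp

variable {D : CovariantDerivative I E (TangentSpace I : N → Type _)}

/-- The vector field `∇_X Y`. -/
def nabla (D : CovariantDerivative I E (TangentSpace I : N → Type _))
    (X Y : Π x : N, TangentSpace I x) (x : N) : TangentSpace I x := D Y x (X x)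

theorem nabla_add_right {X Y Z : Π x : N, TangentSpace I x} (hY : IsSmoothField I Y)
    (hZ : IsSmoothField I Z) : nabla D X (Y + Z) = nabla D X Y + nabla D X Z := by
  funext x
  unfold nabla
  rw [D.isCovariantDerivativeOnUniv.add (hY.mdifferentiableAt x) (hZ.mdifferentiableAt x)]
  rfl

theorem nabla_smul_right {X Y : Π x : N, TangentSpace I x} {f : N → ℝ}
    (hf : ContMDiff I 𝓘(ℝ, ℝ) ∞ f) (hY : IsSmoothField I Y) (x : N) :
    nabla D X (f • Y) x = f x • nabla D X Y x + dirDeriv I X f x • Y x := by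
  unfold nabla dirDeriv
  rw [D.isCovariantDerivativeOnUniv.leibniz (hY.mdifferentiableAt x)
    ((hf x).mdifferentiableAt (by simp))]
  rfl

theorem nabla_neg_right {X Y : Π x : N, TangentSpace I x} (hY : IsSmoothField I Y) :
    nabla D X (-Y) = -nabla D X Y := by
  funext x
  have h := D.isCovariantDerivativeOnUniv.smul_const (-1 : ℝ) (hY.mdifferentiableAt x)
  rw [neg_one_smul, neg_one_smul] at h
  exact congrArg (fun L : E →L[ℝ] E => L (X x)) h

namespace IsLeviCivita

variable [FiniteDimensional ℝ E] {g : Π x : N, TangentSpace I x → TangentSpace I x → ℝ}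
  {X Y Z : Π x : N, TangentSpace I x}

theorem isSmoothField_nabla (h : IsLeviCivita I g D) (hX : IsSmoothField I X)
    (hY : IsSmoothField I Y) : IsSmoothField I (nabla D X Y) := by
  have h1 := h.smooth.contMDiff.contMDiff (σ := Y) (contMDiffOn_univ.2 hY)
  exact ContMDiff.clm_bundle_apply (contMDiffOn_univ.1 h1) hX

theorem mlieBracket_eq (h : IsLeviCivita I g D) (hX : IsSmoothField I X)
    (hY : IsSmoothField I Y) : mlieBracket I X Y = nabla D X Y - nabla D Y X := by
  have : IsManifold I 2 N := IsManifold.of_le (n := ∞) ENat.LEInfty.out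
  have : CompleteSpace E := FiniteDimensional.complete ℝ E
  funext x
  exact ((CovariantDerivative.torsion_eq_zero_iff D).1 h.torsion_eq_zero
    (hX.mdifferentiableAt x) (hY.mdifferentiableAt x)).symm

/-- Zero torsion expresses the bracket through covariant derivatives, which are smooth. -/
theorem isSmoothField_mlieBracket (h : IsLeviCivita I g D) (hX : IsSmoothField I X)
    (hY : IsSmoothField I Y) : IsSmoothField I (mlieBracket I X Y) := by
  rw [h.mlieBracket_eq hX hY, sub_eq_add_neg]
  exact (h.isSmoothField_nabla hX hY).add (h.isSmoothField_nabla hY hX).neg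

theorem dirDeriv_eq (h : IsLeviCivita I g D) (hX : IsSmoothField I X) (hY : IsSmoothField I Y)
    (hZ : IsSmoothField I Z) (x : N) :
    dirDeriv I X (fun y => g y (Y y) (Z y)) x
      = g x (nabla D X Y x) (Z x) + g x (Y x) (nabla D X Z x) :=
  h.metric X Y Z hX hY hZ x

/-- The Koszul formula. -/
theorem koszul (h : IsLeviCivita I g D)
    (hsymm : ∀ x u v, g x u v = g x v u)
    (hsub : ∀ x u v w, g x (u - v) w = g x u w - g x v w)
    (hX : IsSmoothField I X) (hY : IsSmoothField I Y) (hZ : IsSmoothField I Z) (x : N) :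
    2 * g x (nabla D X Y x) (Z x)
      = dirDeriv I X (fun y => g y (Y y) (Z y)) x + dirDeriv I Y (fun y => g y (X y) (Z y)) x
        - dirDeriv I Z (fun y => g y (X y) (Y y)) x + g x (mlieBracket I X Y x) (Z x)
        - g x (mlieBracket I X Z x) (Y x) - g x (mlieBracket I Y Z x) (X x) := by
  rw [h.mlieBracket_eq hX hY, h.mlieBracket_eq hX hZ, h.mlieBracket_eq hY hZ,
    h.dirDeriv_eq hX hY hZ, h.dirDeriv_eq hY hX hZ, h.dirDeriv_eq hZ hX hY]
  simp only [Pi.sub_apply, hsub]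
  rw [hsymm x (X x), hsymm x (X x), hsymm x (Y x) (nabla D X Z x)]
  ring

end IsLeviCivita

end SmoothFields

/-! ### Pointwise algebra of the metric and J -/

namespace KahlerSurface

variable {M : Type*} [TopologicalSpace M] [ChartedSpace (EuclideanSpace ℝ (Fin 4)) M]
  [IsManifold (𝓡 4) ∞ M] (K : KahlerSurface M) (x : M) (u v w : TangentSpace (𝓡 4) x)

theorem g_comm : K.g x u v = K.g x v u := K.metric.symm x u v

theorem g_add_left : K.g x (u + v) w = K.g x u w + K.g x v w :=
  congrArg (fun L : TangentSpace (𝓡 4) x →L[ℝ] ℝ => L w) (map_add (K.metric.inner x) u v)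

theorem g_sub_left : K.g x (u - v) w = K.g x u w - K.g x v w :=
  congrArg (fun L : TangentSpace (𝓡 4) x →L[ℝ] ℝ => L w) (map_sub (K.metric.inner x) u v)

theorem g_neg_left : K.g x (-u) w = -K.g x u w :=
  congrArg (fun L : TangentSpace (𝓡 4) x →L[ℝ] ℝ => L w) (map_neg (K.metric.inner x) u)

theorem g_zero_left : K.g x 0 w = 0 :=
  congrArg (fun L : TangentSpace (𝓡 4) x →L[ℝ] ℝ => L w) (map_zero (K.metric.inner x))

theorem g_smul_left (c : ℝ) : K.g x (c • u) w = c * K.g x u w :=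
  congrArg (fun L : TangentSpace (𝓡 4) x →L[ℝ] ℝ => L w) (map_smul (K.metric.inner x) c u)

theorem g_zero_right : K.g x w 0 = 0 := map_zero (K.metric.inner x w)

theorem g_neg_right : K.g x w (-u) = -K.g x w u := map_neg (K.metric.inner x w) u

variable {x u v} in
theorem eq_of_forall_g (h : ∀ w, K.g x u w = K.g x v w) : u = v := by
  by_contra hne
  have h1 := K.metric.pos x (u - v) (sub_ne_zero.2 hne)
  have h2 := K.g_sub_left x u v (u - v)
  rw [h, sub_self] at h2
  exact h1.ne' h2

theorem g_J_J : K.g x (K.J x u) (K.J x v) = K.g x u v := K.J_orthogonal x u v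

/-- An orthogonal J with J² = −1 is skew-adjoint. -/
theorem g_J_right : K.g x u (K.J x v) = -K.g x (K.J x u) v := by
  rw [← K.g_J_J x u, K.J_sq, g_neg_right]

end KahlerSurface
-- The complex structure is parallel
namespace KahlerSurface

variable {M : Type*} [TopologicalSpace M] [ChartedSpace (EuclideanSpace ℝ (Fin 4)) M]
  [IsManifold (𝓡 4) ∞ M] (K : KahlerSurface M)

/-- The vector field `JX`. -/
def jField (X : Π x : M, TangentSpace (𝓡 4) x) (x : M) : TangentSpace (𝓡 4) x := K.J x (X x)

theorem jField_jField (X : Π x : M, TangentSpace (𝓡 4) x) : K.jField (K.jField X) = -X :=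
  funext fun x => K.J_sq x (X x)

variable {K} {X Y Z : Π x : M, TangentSpace (𝓡 4) x}

variable (K) in
theorem isSmoothField_jField (hX : IsSmoothField (𝓡 4) X) : IsSmoothField (𝓡 4) (K.jField X) :=
  ContMDiff.clm_bundle_apply K.J_smooth hX

theorem contMDiff_g (hX : IsSmoothField (𝓡 4) X) (hY : IsSmoothField (𝓡 4) Y) :
    ContMDiff (𝓡 4) 𝓘(ℝ, ℝ) ∞ (fun x => K.g x (X x) (Y x)) := by
  intro x
  have h := ContMDiffAt.clm_bundle_apply₂ (F₁ := EuclideanSpace ℝ (Fin 4))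
    (F₂ := EuclideanSpace ℝ (Fin 4)) (E₃ := Bundle.Trivial M ℝ) (F₃ := ℝ)
    (K.metric.contMDiff x) (hX x) (hY x)
  simp only [contMDiffAt_totalSpace] at h
  exact h.2

variable {D : CovariantDerivative (𝓡 4) (EuclideanSpace ℝ (Fin 4))
  (TangentSpace (𝓡 4) : M → Type _)}

variable (K D) in
/-- The vector field `(∇_X J) Y`. -/
def nablaJ (X Y : Π x : M, TangentSpace (𝓡 4) x) : Π x : M, TangentSpace (𝓡 4) x :=
  nabla D X (K.jField Y) - K.jField (nabla D X Y)

theorem g_nablaJ (hD : IsLeviCivita (𝓡 4) K.g D) (hX : IsSmoothField (𝓡 4) X)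
    (hY : IsSmoothField (𝓡 4) Y) (hZ : IsSmoothField (𝓡 4) Z) (x : M) :
    K.g x (K.nablaJ D X Y x) (Z x)
      = dirDeriv (𝓡 4) X (fun y => K.g y (K.J y (Y y)) (Z y)) x
        - K.g x (K.J x (Y x)) (nabla D X Z x) - K.g x (K.J x (nabla D X Y x)) (Z x) := by
  have h1 := hD.dirDeriv_eq hX (isSmoothField_jField K hY) hZ x
  have h2 := K.g_sub_left x (nabla D X (K.jField Y) x) (K.J x (nabla D X Y x)) (Z x)
  unfold jField at h1 h2
  rw [h1]
  exact h2.trans (by ring)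

/-- The metric is parallel, so the derivative of the skew endomorphism J is again skew. -/
theorem g_nablaJ_skew (hD : IsLeviCivita (𝓡 4) K.g D) (hX : IsSmoothField (𝓡 4) X)
    (hY : IsSmoothField (𝓡 4) Y) (hZ : IsSmoothField (𝓡 4) Z) (x : M) :
    K.g x (K.nablaJ D X Y x) (Z x) = -K.g x (K.nablaJ D X Z x) (Y x) := by
  rw [g_nablaJ hD hX hY hZ, g_nablaJ hD hX hZ hY]
  have h3 : (fun y => K.g y (K.J y (Z y)) (Y y)) = -fun y => K.g y (K.J y (Y y)) (Z y) :=
    funext fun y => by rw [K.g_comm y]; exact K.g_J_right y _ _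
  rw [h3, dirDeriv_neg, K.g_comm x (K.J x (Z x)), K.g_comm x (K.J x (nabla D X Z x)), g_J_right, g_J_right]
  ring

/-- Obtained by differentiating J² = −1. -/
theorem nablaJ_jField (hY : IsSmoothField (𝓡 4) Y) :
    K.nablaJ D X (K.jField Y) = -K.jField (K.nablaJ D X Y) := by
  funext x
  have h : ∀ u v : TangentSpace (𝓡 4) x, -u - K.J x v = -K.J x (v - K.J x u) := by
    intro u v
    rw [map_sub, K.J_sq]
    abel
  unfold nablaJ
  rw [jField_jField, nabla_neg_right hY]
  exact h (nabla D X Y x) (nabla D X (K.jField Y) x)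

theorem g_nablaJ_jField (hY : IsSmoothField (𝓡 4) Y) (x : M) (w : TangentSpace (𝓡 4) x) :
    K.g x (K.nablaJ D X (K.jField Y) x) w = K.g x (K.nablaJ D X Y x) (K.J x w) := by
  rw [nablaJ_jField hY, g_J_right]
  exact K.g_neg_left x _ w

/-- This is dω = 0: once brackets are written with the torsion-free connection, the derivatives of
the arguments cancel and only those of J remain. -/
theorem g_nablaJ_cyclic (hD : IsLeviCivita (𝓡 4) K.g D) (hX : IsSmoothField (𝓡 4) X)
    (hY : IsSmoothField (𝓡 4) Y) (hZ : IsSmoothField (𝓡 4) Z) (x : M) :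
    K.g x (K.nablaJ D X Y x) (Z x) + K.g x (K.nablaJ D Y Z x) (X x)
      + K.g x (K.nablaJ D Z X x) (Y x) = 0 := by
  have h := K.closed X Y Z hX hY hZ x
  unfold cartanTwoForm at h
  rw [hD.mlieBracket_eq hX hY, hD.mlieBracket_eq hX hZ, hD.mlieBracket_eq hY hZ] at h
  change dirDeriv (𝓡 4) X (fun y => K.g y (K.J y (Y y)) (Z y)) x
    - dirDeriv (𝓡 4) Y (fun y => K.g y (K.J y (X y)) (Z y)) x
    + dirDeriv (𝓡 4) Z (fun y => K.g y (K.J y (X y)) (Y y)) x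
    - K.g x (K.J x (nabla D X Y x - nabla D Y X x)) (Z x)
    + K.g x (K.J x (nabla D X Z x - nabla D Z X x)) (Y x)
    - K.g x (K.J x (nabla D Y Z x - nabla D Z Y x)) (X x) = 0 at h
  rw [map_sub, map_sub, map_sub, g_sub_left, g_sub_left, g_sub_left] at h
  have h5 : ∀ u v, K.g x (K.J x u) v = -K.g x (K.J x v) u := fun u v => by
    rw [K.g_comm x, g_J_right]
  rw [g_nablaJ_skew hD hY hZ hX, g_nablaJ hD hX hY hZ, g_nablaJ hD hY hX hZ,
    g_nablaJ hD hZ hX hY]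
  linarith [h5 (X x) (nabla D Y Z x), h5 (X x) (nabla D Z Y x), h5 (Y x) (nabla D X Z x)]

/-- Integrability rewritten in the same way: after the brackets are expanded, only derivatives of J
survive. -/
theorem g_nablaJ_nijenhuis (hD : IsLeviCivita (𝓡 4) K.g D) (hX : IsSmoothField (𝓡 4) X)
    (hY : IsSmoothField (𝓡 4) Y) (x : M) (w : TangentSpace (𝓡 4) x) :
    K.g x (K.nablaJ D (K.jField X) Y x) w - K.g x (K.nablaJ D (K.jField Y) X x) w
      - K.g x (K.nablaJ D Y X x) (K.J x w) + K.g x (K.nablaJ D X Y x) (K.J x w) = 0 := by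
  have h := congrArg (fun u => K.g x u w) (K.J_integrable X Y hX hY x)
  have hJX := isSmoothField_jField K hX
  have hJY := isSmoothField_jField K hY
  change K.g x (mlieBracket (𝓡 4) (K.jField X) (K.jField Y) x
    - K.J x (mlieBracket (𝓡 4) (K.jField X) Y x) - K.J x (mlieBracket (𝓡 4) X (K.jField Y) x)
    - mlieBracket (𝓡 4) X Y x) w = K.g x 0 w at h
  rw [hD.mlieBracket_eq hJX hJY, hD.mlieBracket_eq hJX hY, hD.mlieBracket_eq hX hJY,
    hD.mlieBracket_eq hX hY] at h
  have hs : ∀ F G : Π x : M, TangentSpace (𝓡 4) x, (F - G) x = F x - G x := fun _ _ => rfl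
  have hj : ∀ F : Π x : M, TangentSpace (𝓡 4) x, K.jField F x = K.J x (F x) := fun _ => rfl
  simp only [g_zero_left, hs, map_sub, g_sub_left, nablaJ, hj, g_J_right, K.J_sq, g_neg_left] at h ⊢
  linarith

/-- The complex structure of a Kähler surface is parallel. -/
theorem nablaJ_eq_zero [T2Space M] (hD : IsLeviCivita (𝓡 4) K.g D) (hX : IsSmoothField (𝓡 4) X)
    (hY : IsSmoothField (𝓡 4) Y) : K.nablaJ D X Y = 0 := by
  funext x
  refine K.eq_of_forall_g fun w => ?_
  obtain ⟨Z, hZ, rfl⟩ := exists_isSmoothField x w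
  have hJX := isSmoothField_jField K hX
  have hJY := isSmoothField_jField K hY
  have hJZ := isSmoothField_jField K hZ
  refine Eq.trans ?_ (K.g_zero_left x (Z x)).symm
  -- Write A(X,Y,Z) = ⟨(∇_X J)Y,Z⟩. Subtract the cyclic identity for (X,JY,JZ) from that for
  -- (X,Y,Z). Since A(X,JY,JZ) = −A(X,Y,Z), this leaves 2A(X,Y,Z) plus four terms, whose sum is zero
  -- by the Nijenhuis identity for Y, Z tested against JX.
  have c1 := g_nablaJ_cyclic hD hX hY hZ x
  have c2 := g_nablaJ_cyclic hD hX hJY hJZ x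
  have n1 := g_nablaJ_nijenhuis hD hY hZ x (K.J x (X x))
  have e1 := g_nablaJ_jField (K := K) (D := D) (X := X) hY x (K.jField Z x)
  have e2 := g_nablaJ_jField (K := K) (D := D) (X := K.jField Y) hZ x (X x)
  have e3 := g_nablaJ_skew hD hJZ hX hJY x
  have e4 := g_nablaJ_jField (K := K) (D := D) (X := K.jField Z) hY x (X x)
  have e5 := g_nablaJ_skew hD hZ hY hX x
  have e6 : K.J x (K.jField Z x) = -Z x := K.J_sq x _
  rw [e6, g_neg_right] at e1
  rw [K.J_sq, g_neg_right, g_neg_right] at n1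
  linarith

end KahlerSurface

/-! ### Derivatives of smooth families of maps -/

section ParametricDerivative

variable {E E' E'' : Type*} [NormedAddCommGroup E] [NormedSpace ℝ E]
  [NormedAddCommGroup E'] [NormedSpace ℝ E'] [NormedAddCommGroup E''] [NormedSpace ℝ E'']
  {H H' H'' : Type*} [TopologicalSpace H] [TopologicalSpace H'] [TopologicalSpace H'']
  {I : ModelWithCorners ℝ E H} {I' : ModelWithCorners ℝ E' H'} {I'' : ModelWithCorners ℝ E'' H''}
  {N N' N'' : Type*} [TopologicalSpace N] [ChartedSpace H N]
  [TopologicalSpace N'] [ChartedSpace H' N'] [TopologicalSpace N''] [ChartedSpace H'' N'']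
  [IsManifold I ∞ N] [IsManifold I' ∞ N'] [IsManifold I'' ∞ N'']

/-- The derivative of a smooth family of maps, applied to a smooth family of tangent vectors. -/
theorem contMDiffAt_mfderiv_apply {f : N → N' → N''} {g : N → N'}
    {v : Π n, TangentSpace I' (g n)} {x : N}
    (hf : ContMDiffAt (I.prod I') I'' ∞ (Function.uncurry f) (x, g x))
    (hg : ContMDiffAt I I' ∞ g x)
    (hv : ContMDiffAt I I'.tangent ∞ (fun n => (⟨g n, v n⟩ : TangentBundle I' N')) x) :
    ContMDiffAt I I''.tangent ∞
      (fun n => (⟨f n (g n), mfderiv I' I'' (f n) (g n) (v n)⟩ : TangentBundle I'' N'')) x :=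
  ContMDiffAt.clm_apply_of_inCoordinates (hf.mfderiv f g hg (by simp)) hv
    (hf.comp x (contMDiffAt_id.prodMk hg))

omit [IsManifold I'' ∞ N''] in
theorem tangentBundle_mk_eq {x y : N''} (h : x = y) (v : E'') :
    (⟨x, v⟩ : TangentBundle I'' N'') = ⟨y, v⟩ := by
  subst h; rfl

end ParametricDerivative

/-! ### Smoothness of ξ and of horizontal lifts, and their brackets -/

namespace CircleBundle

variable {M Mbar : Type*} [TopologicalSpace M]
    [ChartedSpace (EuclideanSpace ℝ (Fin 4)) M] [IsManifold (𝓡 4) ∞ M]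
    [TopologicalSpace Mbar] [ChartedSpace (EuclideanSpace ℝ (Fin 5)) Mbar]
    [IsManifold (𝓡 5) ∞ Mbar] [MulAction Circle Mbar] {P : CircleBundle M Mbar}

variable (P) in
theorem isSmoothField_generator : IsSmoothField (𝓡 5) P.generator := by
  intro x
  have hf : ContMDiff ((𝓡 5).prod 𝓘(ℝ, ℝ)) (𝓡 5) ∞
      (Function.uncurry fun (y : Mbar) (t : ℝ) => Circle.exp t • y) :=
    P.smooth_action.comp ((contMDiff_circleExp.comp contMDiff_snd).prodMk contMDiff_fst)
  have hv : ContMDiff (𝓡 5) 𝓘(ℝ, ℝ).tangent ∞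
      (fun _ : Mbar => (⟨0, (1 : ℝ)⟩ : TangentBundle 𝓘(ℝ, ℝ) ℝ)) := contMDiff_const
  have h := contMDiffAt_mfderiv_apply (hf (x, 0)) contMDiffAt_const (hv x)
  refine h.congr_of_eventuallyEq (Filter.Eventually.of_forall fun y => ?_)
  exact (tangentBundle_mk_eq (by simp) _).symm

/-- Near every point there is a smooth section of `T Mbar` projecting to a given field. -/
theorem exists_local_lift {X : Π m : M, TangentSpace (𝓡 4) m} (hX : IsSmoothField (𝓡 4) X)
    (x : Mbar) : ∃ V : Π y : Mbar, TangentSpace (𝓡 5) y,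
      ContMDiffAt (𝓡 5) (𝓡 5).tangent ∞ (fun y => (⟨y, V y⟩ : TangentBundle (𝓡 5) Mbar)) x ∧
      ∀ᶠ y in nhds x, P.dproj y (V y) = X (P.proj y) := by
  obtain ⟨U, φ, hU, hm, hs, ht, hφ, hφ', hpr, -⟩ := P.local_triv (P.proj x)
  -- `f y` is the local section through `y` with constant circle coordinate; its differential
  -- applied to X is the desired lift.
  let f : Mbar → M → Mbar := fun y m => φ.symm (m, (φ y).2)
  have hx : x ∈ φ.source := by rw [hs]; exact hm
  have hsrc : ∀ᶠ y in nhds x, y ∈ φ.source := φ.open_source.mem_nhds hx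
  have hφy : ∀ y ∈ φ.source, φ y = (P.proj y, (φ y).2) := fun y hy => Prod.ext (hpr y hy) rfl
  have hmem : ∀ y ∈ φ.source, (P.proj y, (φ y).2) ∈ φ.target := fun y hy => by
    rw [← hφy y hy]; exact φ.map_source hy
  have hback : ∀ y ∈ φ.source, f y (P.proj y) = y := fun y hy => by
    change φ.symm (P.proj y, (φ y).2) = y
    rw [← hφy y hy]; exact φ.left_inv hy
  have hf : ContMDiffAt ((𝓡 5).prod (𝓡 4)) (𝓡 5) ∞ (Function.uncurry f) (x, P.proj x) := by
    have h1 : ContMDiffAt ((𝓡 5).prod (𝓡 4)) ((𝓡 4).prod (𝓡 1)) ∞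
        (fun q : Mbar × M => (q.2, (φ q.1).2)) (x, P.proj x) :=
      contMDiffAt_snd.prodMk (contMDiffAt_snd.comp _
        (((hφ x hx).contMDiffAt hsrc).comp (x, P.proj x) contMDiffAt_fst))
    exact ((hφ' _ (hmem x hx)).contMDiffAt (φ.open_target.mem_nhds (hmem x hx))).comp
      (x, P.proj x) h1
  have h := contMDiffAt_mfderiv_apply hf (P.smooth_proj x)
    (v := fun y => X (P.proj y)) ((hX (P.proj x)).comp x (P.smooth_proj x))
  refine ⟨fun y => mfderiv (𝓡 4) (𝓡 5) (f y) (P.proj y) (X (P.proj y)), ?_, ?_⟩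
  · refine h.congr_of_eventuallyEq ?_
    filter_upwards [hsrc] with y hy
    exact (tangentBundle_mk_eq (hback y hy) _).symm
  · filter_upwards [hsrc] with y hy
    have hev : (P.proj ∘ f y) =ᶠ[nhds (P.proj y)] id := by
      have hUy : U ∈ nhds (P.proj y) := hU.mem_nhds (by rw [hs] at hy; exact hy)
      filter_upwards [hUy] with m hm
      have hmt : (m, (φ y).2) ∈ φ.target := by rw [ht]; exact ⟨hm, trivial⟩
      have := hpr _ (φ.map_target hmt)
      rw [φ.right_inv hmt] at this
      exact this.symm
    have h12 : MDifferentiableAt (𝓡 4) (𝓡 5) (f y) (P.proj y) :=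
      (((hφ' _ (hmem y hy)).contMDiffAt (φ.open_target.mem_nhds (hmem y hy))).mdifferentiableAt
        (by simp)).comp (P.proj y) (mdifferentiableAt_id.prodMk mdifferentiableAt_const)
    have h3 : MDifferentiableAt (𝓡 5) (𝓡 4) P.proj (f y (P.proj y)) :=
      (P.smooth_proj _).mdifferentiableAt (by simp)
    have hcomp := mfderiv_comp (P.proj y) h3 h12
    rw [hev.mfderiv_eq, mfderiv_id, hback y hy] at hcomp
    exact (congrArg (fun L => L (X (P.proj y))) hcomp).symm

namespace Connection

variable {A : P.Connection}

variable (A) in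
theorem isSmoothField_xi : IsSmoothField (𝓡 5) A.xi :=
  P.isSmoothField_generator.const_smul A.scale⁻¹

/-- The pair (dπ, η) is injective on each tangent space, so vector identities upstairs split into a
horizontal and a vertical check. -/
theorem eq_of_dproj_form {x : Mbar} {u v : TangentSpace (𝓡 5) x}
    (h : P.dproj x u = P.dproj x v) (h' : A.form x u = A.form x v) : u = v := by
  have h0 := (A.existsUnique_horizontal x 0).unique (y₁ := u - v) (y₂ := 0)
    ⟨by rw [map_sub, h, sub_self], by rw [map_sub, h', sub_self]⟩ ⟨map_zero _, map_zero _⟩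
  exact sub_eq_zero.1 h0

variable (A) in
theorem isSmoothField_lift {X : Π m : M, TangentSpace (𝓡 4) m} (hX : IsSmoothField (𝓡 4) X) :
    IsSmoothField (𝓡 5) (A.lift X) := by
  intro x
  obtain ⟨V, hV, hVX⟩ := exists_local_lift (P := P) hX x
  have hη : ContMDiffAt (𝓡 5) 𝓘(ℝ, ℝ) ∞ (fun y => A.form y (V y)) x := by
    have h := ContMDiffAt.clm_bundle_apply (E₂ := Bundle.Trivial Mbar ℝ) (A.smooth x) hV
    simp only [contMDiffAt_totalSpace] at h
    exact h.2
  -- Removing η(V)ξ from any smooth local lift V makes it horizontal, hence equal to the horizontal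
  -- lift by uniqueness.
  have h := ContMDiffAt.add_section hV ((hη.neg).smul_section (isSmoothField_xi A x))
  refine h.congr_of_eventuallyEq ?_
  filter_upwards [hVX] with y hy
  congr 1
  refine eq_of_dproj_form (A := A) ?_ ?_
  · have : P.dproj y (V y + (-A.form y (V y)) • A.xi y) = X (P.proj y) := by
      rw [map_add, map_smul, A.dproj_xi, smul_zero, add_zero, hy]
    exact (A.dproj_lift X y).trans this.symm
  · have : A.form y (V y + (-A.form y (V y)) • A.xi y) = 0 := by
      rw [map_add, map_smul, A.form_xi, smul_eq_mul, mul_one, add_neg_cancel]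
    exact (A.form_lift X y).trans this.symm

variable {X Y : Π m : M, TangentSpace (𝓡 4) m}

theorem dproj_mlieBracket_lift (hX : IsSmoothField (𝓡 4) X) (hY : IsSmoothField (𝓡 4) Y)
    (x : Mbar) : P.dproj x (mlieBracket (𝓡 5) (A.lift X) (A.lift Y) x)
      = mlieBracket (𝓡 4) X Y (P.proj x) :=
  mfderiv_mlieBracket_of_related P.smooth_proj ((isSmoothField_lift A hX).mdifferentiableAt x)
    ((isSmoothField_lift A hY).mdifferentiableAt x) (hX.mdifferentiableAt _)
    (hY.mdifferentiableAt _) (A.dproj_lift X) (A.dproj_lift Y)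

/-- ξ is π-related to the zero field. -/
theorem dproj_mlieBracket_xi (hX : IsSmoothField (𝓡 4) X) (x : Mbar) :
    P.dproj x (mlieBracket (𝓡 5) A.xi (A.lift X) x) = 0 := by
  have h := mfderiv_mlieBracket_of_related P.smooth_proj
    ((isSmoothField_xi A).mdifferentiableAt x) ((isSmoothField_lift A hX).mdifferentiableAt x)
    (IsSmoothField.zero.mdifferentiableAt _) (hX.mdifferentiableAt _) A.dproj_xi (A.dproj_lift X)
  rw [mlieBracket_zero_left] at h
  exact h

variable {p : ℤ} {K : KahlerSurface M}

/-- η vanishes on both lifts, so dη reduces to −½η of the bracket; the normalization ½ is the source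
of the 2. -/
theorem form_mlieBracket_lift (hA : A.HasCurvature p K) (hX : IsSmoothField (𝓡 4) X)
    (hY : IsSmoothField (𝓡 4) Y) (x : Mbar) :
    A.form x (mlieBracket (𝓡 5) (A.lift X) (A.lift Y) x)
      = -2 * p * K.g (P.proj x) (K.J _ (X (P.proj x))) (Y (P.proj x)) := by
  have h := hA _ _ (isSmoothField_lift A hX) (isSmoothField_lift A hY) x
  unfold extDerivOneForm KahlerSurface.kahlerForm at h
  simp only [A.form_lift, A.dproj_lift, dirDeriv_const] at h
  linarith

/-- The vertical component vanishes because dη is pulled back from the base up to a factor and so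
annihilates ξ, while η(ξ) and η(X^L) are constant. -/
theorem mlieBracket_xi_lift (hA : A.HasCurvature p K) (hX : IsSmoothField (𝓡 4) X) :
    mlieBracket (𝓡 5) A.xi (A.lift X) = 0 := by
  funext x
  refine eq_of_dproj_form (A := A) ((dproj_mlieBracket_xi hX x).trans (map_zero _).symm)
    (Eq.trans ?_ (map_zero _).symm)
  have h := hA _ _ (isSmoothField_xi A) (isSmoothField_lift A hX) x
  unfold extDerivOneForm KahlerSurface.kahlerForm at h
  simp only [A.form_lift, A.form_xi, A.dproj_xi, dirDeriv_const, map_zero, KahlerSurface.g_zero_left] at h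
  linarith

end Connection
end CircleBundle
-- The Levi-Civita connection of the total space
namespace CircleBundle
namespace Connection

variable {M Mbar : Type*} [TopologicalSpace M]
    [ChartedSpace (EuclideanSpace ℝ (Fin 4)) M] [IsManifold (𝓡 4) ∞ M]
    [TopologicalSpace Mbar] [ChartedSpace (EuclideanSpace ℝ (Fin 5)) Mbar]
    [IsManifold (𝓡 5) ∞ Mbar] [MulAction Circle Mbar] {P : CircleBundle M Mbar}
    {A : P.Connection} {p : ℤ} {K : KahlerSurface M}
    {D : CovariantDerivative (𝓡 4) (EuclideanSpace ℝ (Fin 4)) (TangentSpace (𝓡 4) : M → Type _)}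
    {Dbar : CovariantDerivative (𝓡 5) (EuclideanSpace ℝ (Fin 5))
      (TangentSpace (𝓡 5) : Mbar → Type _)}
    {X Y Z : Π m : M, TangentSpace (𝓡 4) m}

theorem gbar_lift (x : Mbar) (u : TangentSpace (𝓡 5) x) (W : Π m : M, TangentSpace (𝓡 4) m) :
    A.gbar K x u (A.lift W x) = K.g (P.proj x) (P.dproj x u) (W (P.proj x)) := by
  rw [gbar, A.dproj_lift, A.form_lift, mul_zero, add_zero]

theorem gbar_xi (x : Mbar) (u : TangentSpace (𝓡 5) x) : A.gbar K x u (A.xi x) = A.form x u := by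
  rw [gbar, A.dproj_xi, A.form_xi, mul_one, KahlerSurface.g_zero_right, zero_add]

theorem gbar_comm (x : Mbar) (u v : TangentSpace (𝓡 5) x) :
    A.gbar K x u v = A.gbar K x v u := by
  rw [gbar, gbar, K.g_comm, mul_comm]

theorem gbar_sub_left (x : Mbar) (u v w : TangentSpace (𝓡 5) x) :
    A.gbar K x (u - v) w = A.gbar K x u w - A.gbar K x v w := by
  rw [gbar, gbar, gbar, map_sub, map_sub, KahlerSurface.g_sub_left]
  ring

theorem dirDeriv_comp_proj {f : M → ℝ} (hf : ContMDiff (𝓡 4) 𝓘(ℝ, ℝ) ∞ f)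
    (V : Π y : Mbar, TangentSpace (𝓡 5) y) (x : Mbar) :
    dirDeriv (𝓡 5) V (fun y => f (P.proj y)) x
      = mvfderiv (𝓡 4) f (P.proj x) (P.dproj x (V x)) :=
  mvfderiv_comp_apply x ((hf _).mdifferentiableAt (by simp))
    ((P.smooth_proj x).mdifferentiableAt (by simp)) (V x)

theorem dirDeriv_lift {f : M → ℝ} (hf : ContMDiff (𝓡 4) 𝓘(ℝ, ℝ) ∞ f) (x : Mbar) :
    dirDeriv (𝓡 5) (A.lift X) (fun y => f (P.proj y)) x = dirDeriv (𝓡 4) X f (P.proj x) := by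
  rw [dirDeriv_comp_proj hf, A.dproj_lift]
  rfl

theorem dirDeriv_xi {f : M → ℝ} (hf : ContMDiff (𝓡 4) 𝓘(ℝ, ℝ) ∞ f) (x : Mbar) :
    dirDeriv (𝓡 5) A.xi (fun y => f (P.proj y)) x = 0 := by
  rw [dirDeriv_comp_proj hf, A.dproj_xi, map_zero]

theorem gbar_lift_lift :
    (fun y => A.gbar K y (A.lift X y) (A.lift Y y))
      = fun y => K.g (P.proj y) (X (P.proj y)) (Y (P.proj y)) := by
  funext y
  rw [gbar_lift, A.dproj_lift]

theorem gbar_lift_xi : (fun y => A.gbar K y (A.lift X y) (A.xi y)) = fun _ => 0 := by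
  funext y
  rw [gbar_xi, A.form_lift]

/-- Tested on three lifts, each term of the Koszul formula upstairs equals its counterpart on the
base. -/
theorem dproj_nabla_lift_lift [T2Space M] (hD : IsLeviCivita (𝓡 4) K.g D)
    (hDbar : IsLeviCivita (𝓡 5) (A.gbar K) Dbar) (hX : IsSmoothField (𝓡 4) X)
    (hY : IsSmoothField (𝓡 4) Y) (x : Mbar) :
    P.dproj x (nabla Dbar (A.lift X) (A.lift Y) x) = nabla D X Y (P.proj x) := by
  refine K.eq_of_forall_g fun w => ?_
  obtain ⟨Z, hZ, rfl⟩ := exists_isSmoothField (P.proj x) w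
  have h := hDbar.koszul gbar_comm gbar_sub_left (isSmoothField_lift A hX)
    (isSmoothField_lift A hY) (isSmoothField_lift A hZ) x
  have h' := hD.koszul K.g_comm K.g_sub_left hX hY hZ (P.proj x)
  have e : ∀ {U V W : Π m : M, TangentSpace (𝓡 4) m}, IsSmoothField (𝓡 4) V →
      IsSmoothField (𝓡 4) W →
      dirDeriv (𝓡 5) (A.lift U) (fun y => A.gbar K y (A.lift V y) (A.lift W y)) x
        = dirDeriv (𝓡 4) U (fun m => K.g m (V m) (W m)) (P.proj x) := by
    intro U V W hV hW
    rw [gbar_lift_lift]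
    exact dirDeriv_lift (KahlerSurface.contMDiff_g hV hW) x
  rw [e hY hZ, e hX hZ, e hX hY, gbar_lift, gbar_lift, gbar_lift, gbar_lift,
    dproj_mlieBracket_lift hX hY, dproj_mlieBracket_lift hX hZ, dproj_mlieBracket_lift hY hZ] at h
  linarith

/-- In the Koszul formula with ξ as third field, all derivatives vanish and ξ commutes with lifts;
only η([X^L,Y^L]) is left. -/
theorem form_nabla_lift_lift (hA : A.HasCurvature p K)
    (hDbar : IsLeviCivita (𝓡 5) (A.gbar K) Dbar) (hX : IsSmoothField (𝓡 4) X)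
    (hY : IsSmoothField (𝓡 4) Y) (x : Mbar) :
    A.form x (nabla Dbar (A.lift X) (A.lift Y) x)
      = -p * K.g (P.proj x) (K.J _ (X (P.proj x))) (Y (P.proj x)) := by
  have h := hDbar.koszul gbar_comm gbar_sub_left (isSmoothField_lift A hX)
    (isSmoothField_lift A hY) (isSmoothField_xi A) x
  have h0 : ∀ u : TangentSpace (𝓡 5) x,
      A.gbar K x ((-0 : Π y : Mbar, TangentSpace (𝓡 5) y) x) u = 0 := fun u => by
    have := gbar_sub_left (A := A) (K := K) x 0 0 u
    rw [sub_self, sub_self] at this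
    rw [neg_zero]
    exact this
  rw [gbar_lift_xi, gbar_lift_xi, gbar_lift_lift, dirDeriv_const, dirDeriv_const,
    dirDeriv_xi (KahlerSurface.contMDiff_g hX hY) x, mlieBracket_swap (V := A.lift X) (W := A.xi),
    mlieBracket_swap (V := A.lift Y) (W := A.xi), mlieBracket_xi_lift hA hX,
    mlieBracket_xi_lift hA hY, h0, h0, gbar_xi, gbar_xi, form_mlieBracket_lift hA hX hY] at h
  linarith

/-- ξ has constant length 1. -/
theorem form_nabla_xi (hDbar : IsLeviCivita (𝓡 5) (A.gbar K) Dbar)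
    {V : Π y : Mbar, TangentSpace (𝓡 5) y} (hV : IsSmoothField (𝓡 5) V) (x : Mbar) :
    A.form x (nabla Dbar V A.xi x) = 0 := by
  have h := hDbar.dirDeriv_eq hV (isSmoothField_xi A) (isSmoothField_xi A) x
  have h1 : (fun y => A.gbar K y (A.xi y) (A.xi y)) = fun _ => 1 := by
    funext y
    rw [gbar_xi, A.form_xi]
  rw [h1, dirDeriv_const, gbar_comm x (A.xi x), gbar_xi] at h
  linarith

theorem dproj_smul_lift (c : ℝ) (X : Π m : M, TangentSpace (𝓡 4) m) (x : Mbar) :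
    P.dproj x ((c • A.lift X) x) = c • X (P.proj x) :=
  (map_smul (P.dproj x) c (A.lift X x)).trans (by rw [A.dproj_lift])

theorem form_smul_lift (c : ℝ) (X : Π m : M, TangentSpace (𝓡 4) m) (x : Mbar) :
    A.form x ((c • A.lift X) x) = 0 :=
  (map_smul (A.form x) c (A.lift X x)).trans (by rw [A.form_lift, smul_zero])

/-- Differentiating ḡ(Z^L, ξ) = 0 along X^L determines the horizontal component from the vertical
part of ∇̄_{X^L} Z^L. -/
theorem nabla_lift_xi [T2Space M] (hA : A.HasCurvature p K)
    (hDbar : IsLeviCivita (𝓡 5) (A.gbar K) Dbar) (hX : IsSmoothField (𝓡 4) X) :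
    nabla Dbar (A.lift X) A.xi = (p : ℝ) • A.lift (K.jField X) := by
  funext x
  refine eq_of_dproj_form (A := A) (K.eq_of_forall_g fun w => ?_) ?_
  · obtain ⟨Z, hZ, rfl⟩ := exists_isSmoothField (P.proj x) w
    have h := hDbar.dirDeriv_eq (isSmoothField_lift A hX) (isSmoothField_lift A hZ)
      (isSmoothField_xi A) x
    rw [gbar_lift_xi, dirDeriv_const, gbar_xi, form_nabla_lift_lift hA hDbar hX hZ,
      gbar_comm x (A.lift Z x), gbar_lift] at h
    rw [dproj_smul_lift, KahlerSurface.g_smul_left, KahlerSurface.jField]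
    linarith
  · rw [form_nabla_xi hDbar (isSmoothField_lift A hX), form_smul_lift]

/-- Zero torsion and [ξ,X^L] = 0 allow the two arguments to be exchanged. -/
theorem nabla_xi_lift [T2Space M] (hA : A.HasCurvature p K)
    (hDbar : IsLeviCivita (𝓡 5) (A.gbar K) Dbar) (hX : IsSmoothField (𝓡 4) X) :
    nabla Dbar A.xi (A.lift X) = (p : ℝ) • A.lift (K.jField X) := by
  have h := hDbar.mlieBracket_eq (isSmoothField_xi A) (isSmoothField_lift A hX)
  rw [mlieBracket_xi_lift hA hX, nabla_lift_xi hA hDbar hX] at h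
  exact sub_eq_zero.1 h.symm

variable (A p K X Y) in
/-- The vertical part of the covariant derivative of a horizontal lift. -/
def verticalPart (x : Mbar) : ℝ :=
  -(p : ℝ) * K.g (P.proj x) (K.jField X (P.proj x)) (Y (P.proj x))

theorem contMDiff_verticalPart (hX : IsSmoothField (𝓡 4) X) (hY : IsSmoothField (𝓡 4) Y) :
    ContMDiff (𝓡 5) 𝓘(ℝ, ℝ) ∞ (verticalPart (P := P) p K X Y) :=
  (contMDiff_const.mul (KahlerSurface.contMDiff_g (KahlerSurface.isSmoothField_jField K hX)
    hY)).comp P.smooth_proj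

theorem nabla_lift_lift [T2Space M] (hA : A.HasCurvature p K) (hD : IsLeviCivita (𝓡 4) K.g D)
    (hDbar : IsLeviCivita (𝓡 5) (A.gbar K) Dbar) (hX : IsSmoothField (𝓡 4) X)
    (hY : IsSmoothField (𝓡 4) Y) :
    nabla Dbar (A.lift X) (A.lift Y)
      = A.lift (nabla D X Y) + verticalPart (P := P) p K X Y • A.xi := by
  funext x
  refine eq_of_dproj_form (A := A) ?_ ?_
  · rw [dproj_nabla_lift_lift hD hDbar hX hY, ← A.dproj_lift (nabla D X Y) x]
    have : P.dproj x (A.lift (nabla D X Y) x + verticalPart (P := P) p K X Y x • A.xi x)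
        = P.dproj x (A.lift (nabla D X Y) x) := by
      rw [map_add, map_smul, A.dproj_xi, smul_zero, add_zero]
    exact this.symm
  · rw [form_nabla_lift_lift hA hDbar hX hY]
    have : A.form x (A.lift (nabla D X Y) x + verticalPart (P := P) p K X Y x • A.xi x)
        = verticalPart (P := P) p K X Y x := by
      rw [map_add, map_smul, A.form_xi, A.form_lift, zero_add, smul_eq_mul, mul_one]
    exact this.symm

/-- The second covariant derivative of a horizontal lift. -/
theorem nabla_nabla_lift [T2Space M] (hA : A.HasCurvature p K) (hD : IsLeviCivita (𝓡 4) K.g D)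
    (hDbar : IsLeviCivita (𝓡 5) (A.gbar K) Dbar) {V : Π y : Mbar, TangentSpace (𝓡 5) y}
    (hY : IsSmoothField (𝓡 4) Y) (hZ : IsSmoothField (𝓡 4) Z) (x : Mbar) :
    nabla Dbar V (nabla Dbar (A.lift Y) (A.lift Z)) x
      = nabla Dbar V (A.lift (nabla D Y Z)) x
        + (verticalPart (P := P) p K Y Z x • nabla Dbar V A.xi x
          + dirDeriv (𝓡 5) V (verticalPart (P := P) p K Y Z) x • A.xi x) := by
  have hv := contMDiff_verticalPart (P := P) (p := p) (K := K) hY hZ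
  rw [nabla_lift_lift hA hD hDbar hY hZ,
    nabla_add_right (isSmoothField_lift A (hD.isSmoothField_nabla hY hZ))
      (IsSmoothField.smul hv (isSmoothField_xi A))]
  exact congrArg (nabla Dbar V (A.lift (nabla D Y Z)) x + ·)
    (nabla_smul_right hv (isSmoothField_xi A) x)

end Connection
end CircleBundle
-- Curvature of the total space
namespace CircleBundle
namespace Connection

variable {M Mbar : Type*} [TopologicalSpace M]
    [ChartedSpace (EuclideanSpace ℝ (Fin 4)) M] [IsManifold (𝓡 4) ∞ M]
    [TopologicalSpace Mbar] [ChartedSpace (EuclideanSpace ℝ (Fin 5)) Mbar]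
    [IsManifold (𝓡 5) ∞ Mbar] [MulAction Circle Mbar] {P : CircleBundle M Mbar}
    {A : P.Connection} {p : ℤ} {K : KahlerSurface M}
    {D : CovariantDerivative (𝓡 4) (EuclideanSpace ℝ (Fin 4)) (TangentSpace (𝓡 4) : M → Type _)}
    {Dbar : CovariantDerivative (𝓡 5) (EuclideanSpace ℝ (Fin 5))
      (TangentSpace (𝓡 5) : Mbar → Type _)}
    {X Y Z : Π m : M, TangentSpace (𝓡 4) m}

theorem mlieBracket_lift_lift (hA : A.HasCurvature p K) (hX : IsSmoothField (𝓡 4) X)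
    (hY : IsSmoothField (𝓡 4) Y) (x : Mbar) :
    mlieBracket (𝓡 5) (A.lift X) (A.lift Y) x
      = A.lift (mlieBracket (𝓡 4) X Y) x + (2 * verticalPart (P := P) p K X Y x) • A.xi x := by
  refine eq_of_dproj_form (A := A) ?_ ?_
  · rw [dproj_mlieBracket_lift hX hY, map_add, map_smul, A.dproj_xi, smul_zero, add_zero,
      A.dproj_lift]
  · rw [form_mlieBracket_lift hA hX hY, map_add, map_smul, A.form_xi, A.form_lift, verticalPart,
      KahlerSurface.jField, smul_eq_mul]
    ring

variable [T2Space M]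

theorem dproj_nabla_nabla_lift (hA : A.HasCurvature p K) (hD : IsLeviCivita (𝓡 4) K.g D)
    (hDbar : IsLeviCivita (𝓡 5) (A.gbar K) Dbar) (hX : IsSmoothField (𝓡 4) X)
    (hY : IsSmoothField (𝓡 4) Y) (hZ : IsSmoothField (𝓡 4) Z) (x : Mbar) :
    P.dproj x (nabla Dbar (A.lift X) (nabla Dbar (A.lift Y) (A.lift Z)) x)
      = nabla D X (nabla D Y Z) (P.proj x)
        + (verticalPart (P := P) p K Y Z x * p) • K.jField X (P.proj x) := by
  rw [nabla_nabla_lift hA hD hDbar hY hZ, map_add, map_add, map_smul, map_smul, A.dproj_xi,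
    smul_zero, add_zero, dproj_nabla_lift_lift hD hDbar hX (hD.isSmoothField_nabla hY hZ),
    nabla_lift_xi hA hDbar hX, dproj_smul_lift, smul_smul]

theorem form_nabla_nabla_lift (hA : A.HasCurvature p K) (hD : IsLeviCivita (𝓡 4) K.g D)
    (hDbar : IsLeviCivita (𝓡 5) (A.gbar K) Dbar) (hX : IsSmoothField (𝓡 4) X)
    (hY : IsSmoothField (𝓡 4) Y) (hZ : IsSmoothField (𝓡 4) Z) (x : Mbar) :
    A.form x (nabla Dbar (A.lift X) (nabla Dbar (A.lift Y) (A.lift Z)) x)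
      = -p * (K.g (P.proj x) (K.jField X (P.proj x)) (nabla D Y Z (P.proj x))
        + dirDeriv (𝓡 4) X (fun m => K.g m (K.jField Y m) (Z m)) (P.proj x)) := by
  have hg := KahlerSurface.contMDiff_g (K := K) (KahlerSurface.isSmoothField_jField K hY) hZ
  have hv : dirDeriv (𝓡 5) (A.lift X) (verticalPart (P := P) p K Y Z) x
      = -p * dirDeriv (𝓡 4) X (fun m => K.g m (K.jField Y m) (Z m)) (P.proj x) :=
    (dirDeriv_lift (contMDiff_const.mul hg) x).trans (dirDeriv_const_mul X _ hg _)
  rw [nabla_nabla_lift hA hD hDbar hY hZ, map_add, map_add, map_smul, map_smul, A.form_xi,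
    form_nabla_lift_lift hA hDbar hX (hD.isSmoothField_nabla hY hZ),
    form_nabla_xi hDbar (isSmoothField_lift A hX), smul_zero, hv, KahlerSurface.jField,
    smul_eq_mul]
  ring

theorem apply_mlieBracket_lift_lift (hA : A.HasCurvature p K)
    (hDbar : IsLeviCivita (𝓡 5) (A.gbar K) Dbar) (hX : IsSmoothField (𝓡 4) X)
    (hY : IsSmoothField (𝓡 4) Y) (hZ : IsSmoothField (𝓡 4) Z) (x : Mbar) :
    Dbar (A.lift Z) x (mlieBracket (𝓡 5) (A.lift X) (A.lift Y) x)
      = nabla Dbar (A.lift (mlieBracket (𝓡 4) X Y)) (A.lift Z) x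
        + (2 * verticalPart (P := P) p K X Y x) • ((p : ℝ) • A.lift (K.jField Z)) x := by
  rw [mlieBracket_lift_lift hA hX hY, map_add, map_smul, ← nabla_xi_lift hA hDbar hZ]
  rfl

/-- The first two corrections come from differentiating the vertical parts, through ∇̄_{X^L} ξ =
p(JX)^L; the third, with its factor 2, from the vertical part of [X^L,Y^L]. -/
theorem dproj_curvature_lift (hA : A.HasCurvature p K) (hD : IsLeviCivita (𝓡 4) K.g D)
    (hDbar : IsLeviCivita (𝓡 5) (A.gbar K) Dbar) (hX : IsSmoothField (𝓡 4) X)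
    (hY : IsSmoothField (𝓡 4) Y) (hZ : IsSmoothField (𝓡 4) Z) (x : Mbar) :
    P.dproj x (curvature (𝓡 5) Dbar (A.lift X) (A.lift Y) (A.lift Z) x)
      = curvature (𝓡 4) D X Y Z (P.proj x)
        + ((verticalPart (P := P) p K Y Z x * p) • K.jField X (P.proj x)
          - (verticalPart (P := P) p K X Z x * p) • K.jField Y (P.proj x)
          - (2 * verticalPart (P := P) p K X Y x * p) • K.jField Z (P.proj x)) := by
  have hB : IsSmoothField (𝓡 4) (mlieBracket (𝓡 4) X Y) :=
    hD.isSmoothField_mlieBracket hX hY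
  change P.dproj x (nabla Dbar (A.lift X) (nabla Dbar (A.lift Y) (A.lift Z)) x
    - nabla Dbar (A.lift Y) (nabla Dbar (A.lift X) (A.lift Z)) x
    - Dbar (A.lift Z) x (mlieBracket (𝓡 5) (A.lift X) (A.lift Y) x))
    = (nabla D X (nabla D Y Z) (P.proj x) - nabla D Y (nabla D X Z) (P.proj x)
      - nabla D (mlieBracket (𝓡 4) X Y) Z (P.proj x)) + _
  rw [map_sub, map_sub, dproj_nabla_nabla_lift hA hD hDbar hX hY hZ,
    dproj_nabla_nabla_lift hA hD hDbar hY hX hZ, apply_mlieBracket_lift_lift hA hDbar hX hY hZ,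
    map_add, map_smul, dproj_smul_lift, dproj_nabla_lift_lift hD hDbar hB hZ, smul_smul]
  abel

theorem form_curvature_lift (hA : A.HasCurvature p K) (hD : IsLeviCivita (𝓡 4) K.g D)
    (hDbar : IsLeviCivita (𝓡 5) (A.gbar K) Dbar) (hX : IsSmoothField (𝓡 4) X)
    (hY : IsSmoothField (𝓡 4) Y) (hZ : IsSmoothField (𝓡 4) Z) (x : Mbar) :
    A.form x (curvature (𝓡 5) Dbar (A.lift X) (A.lift Y) (A.lift Z) x) = 0 := by
  have hB : IsSmoothField (𝓡 4) (mlieBracket (𝓡 4) X Y) :=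
    hD.isSmoothField_mlieBracket hX hY
  have hJX := KahlerSurface.isSmoothField_jField K hX
  have hJY := KahlerSurface.isSmoothField_jField K hY
  -- The Kähler condition enters here: ∇_Y(JX) = J∇_Y X and symmetrically, so the derivatives of ω
  -- cancel against J[X,Y].
  have hparX := sub_eq_zero.1 (KahlerSurface.nablaJ_eq_zero hD hY hX)
  have hparY := sub_eq_zero.1 (KahlerSurface.nablaJ_eq_zero hD hX hY)
  change A.form x (nabla Dbar (A.lift X) (nabla Dbar (A.lift Y) (A.lift Z)) x
    - nabla Dbar (A.lift Y) (nabla Dbar (A.lift X) (A.lift Z)) x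
    - Dbar (A.lift Z) x (mlieBracket (𝓡 5) (A.lift X) (A.lift Y) x)) = 0
  rw [map_sub, map_sub, form_nabla_nabla_lift hA hD hDbar hX hY hZ,
    form_nabla_nabla_lift hA hD hDbar hY hX hZ, apply_mlieBracket_lift_lift hA hDbar hX hY hZ,
    map_add, map_smul, form_smul_lift, form_nabla_lift_lift hA hDbar hB hZ, smul_zero,
    hD.dirDeriv_eq hX hJY hZ, hD.dirDeriv_eq hY hJX hZ, hparX, hparY, hD.mlieBracket_eq hX hY]
  have h : K.g (P.proj x) (K.J (P.proj x) ((nabla D X Y - nabla D Y X) (P.proj x)))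
      (Z (P.proj x)) = K.g (P.proj x) (K.jField (nabla D X Y) (P.proj x)) (Z (P.proj x))
        - K.g (P.proj x) (K.jField (nabla D Y X) (P.proj x)) (Z (P.proj x)) := by
    rw [← KahlerSurface.g_sub_left]
    exact congrArg (fun u => K.g (P.proj x) u (Z (P.proj x))) (map_sub (K.J (P.proj x)) _ _)
  rw [h]
  ring

theorem form_curvature_xi (hA : A.HasCurvature p K) (hD : IsLeviCivita (𝓡 4) K.g D)
    (hDbar : IsLeviCivita (𝓡 5) (A.gbar K) Dbar) (hX : IsSmoothField (𝓡 4) X)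
    (hY : IsSmoothField (𝓡 4) Y) (x : Mbar) :
    A.form x (curvature (𝓡 5) Dbar A.xi (A.lift X) (A.lift Y) x)
      = (p : ℝ) ^ 2 * K.g (P.proj x) (X (P.proj x)) (Y (P.proj x)) := by
  have hJY := KahlerSurface.isSmoothField_jField K hY
  have hg := KahlerSurface.contMDiff_g (K := K) (KahlerSurface.isSmoothField_jField K hX) hY
  -- The coefficient is pulled back from the base, hence constant along the fibres.
  have hv : dirDeriv (𝓡 5) A.xi (verticalPart (P := P) p K X Y) x = 0 :=
    dirDeriv_xi (contMDiff_const.mul hg) x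
  have hJ : nabla Dbar (A.lift X) ((p : ℝ) • A.lift (K.jField Y)) x
      = (p : ℝ) • nabla Dbar (A.lift X) (A.lift (K.jField Y)) x :=
    congrArg (fun L => L (A.lift X x)) (Dbar.isCovariantDerivativeOnUniv.smul_const (p : ℝ)
      ((isSmoothField_lift A hJY).mdifferentiableAt x))
  change A.form x (nabla Dbar A.xi (nabla Dbar (A.lift X) (A.lift Y)) x
    - nabla Dbar (A.lift X) (nabla Dbar A.xi (A.lift Y)) x
    - Dbar (A.lift Y) x (mlieBracket (𝓡 5) A.xi (A.lift X) x)) = _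
  have h0 : Dbar (A.lift Y) x (mlieBracket (𝓡 5) A.xi (A.lift X) x) = 0 := by
    rw [mlieBracket_xi_lift hA hX]
    exact map_zero _
  rw [h0, sub_zero, map_sub, nabla_nabla_lift hA hD hDbar hX hY, map_add, map_add, map_smul,
    map_smul, hv, zero_smul, form_nabla_xi hDbar (isSmoothField_xi A), smul_zero,
    nabla_xi_lift hA hDbar (hD.isSmoothField_nabla hX hY), form_smul_lift,
    nabla_xi_lift hA hDbar hY, hJ, map_smul, form_nabla_lift_lift hA hDbar hX hJY,
    KahlerSurface.jField, KahlerSurface.g_J_J, smul_eq_mul]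
  ring

end Connection
end CircleBundle
end KahlerCircle

end

theorem mainTheorem6
    {M Mbar : Type*}
    [TopologicalSpace M] [T2Space M] [SecondCountableTopology M]
    [ChartedSpace (EuclideanSpace ℝ (Fin 4)) M] [IsManifold (𝓡 4) ∞ M]
    [TopologicalSpace Mbar] [T2Space Mbar] [SecondCountableTopology Mbar]
    [ChartedSpace (EuclideanSpace ℝ (Fin 5)) Mbar] [IsManifold (𝓡 5) ∞ Mbar]
    [MulAction Circle Mbar]
    (K : KahlerCircle.KahlerSurface M) (p : ℤ)
    (P : KahlerCircle.CircleBundle M Mbar) (A : P.Connection) (hA : A.HasCurvature p K)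
    (D : CovariantDerivative (𝓡 4) (EuclideanSpace ℝ (Fin 4)) (TangentSpace (𝓡 4) : M → Type _))
    (hD : KahlerCircle.IsLeviCivita (𝓡 4) K.g D)
    (Dbar : CovariantDerivative (𝓡 5) (EuclideanSpace ℝ (Fin 5))
      (TangentSpace (𝓡 5) : Mbar → Type _))
    (hDbar : KahlerCircle.IsLeviCivita (𝓡 5) (A.gbar K) Dbar)
    (X Y Z W : Π m : M, TangentSpace (𝓡 4) m)
    (hX : KahlerCircle.IsSmoothField (𝓡 4) X) (hY : KahlerCircle.IsSmoothField (𝓡 4) Y)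
    (hZ : KahlerCircle.IsSmoothField (𝓡 4) Z) (hW : KahlerCircle.IsSmoothField (𝓡 4) W)
    (x : Mbar) (m : M) (hm : m = P.proj x) :
    A.gbar K x (KahlerCircle.curvature (𝓡 5) Dbar (A.lift X) (A.lift Y) (A.lift Z) x)
        (A.lift W x)
      = K.g m (KahlerCircle.curvature (𝓡 4) D X Y Z m) (W m)
        + (p : ℝ) ^ 2 *
          (-(K.g m (K.J m (Y m)) (Z m) * K.g m (K.J m (X m)) (W m))
            + K.g m (K.J m (X m)) (Z m) * K.g m (K.J m (Y m)) (W m)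
            + 2 * K.g m (K.J m (X m)) (Y m) * K.g m (K.J m (Z m)) (W m)) ∧
    A.gbar K x (KahlerCircle.curvature (𝓡 5) Dbar (A.lift X) (A.lift Y) (A.lift Z) x)
        (A.xi x) = 0 ∧
    A.gbar K x (KahlerCircle.curvature (𝓡 5) Dbar A.xi (A.lift X) (A.lift Y) x) (A.xi x)
      = (p : ℝ) ^ 2 * K.g m (X m) (Y m) := by
  subst hm
  open KahlerCircle CircleBundle.Connection KahlerSurface in
  refine ⟨?_, ?_, ?_⟩
  · rw [gbar_lift, dproj_curvature_lift hA hD hDbar hX hY hZ, g_add_left, g_sub_left, g_sub_left,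
      g_smul_left, g_smul_left, g_smul_left]
    -- Each coefficient carries −p and each covariant derivative involving ξ another p, giving the
    -- common factor p².
    unfold verticalPart jField
    ring
  · rw [gbar_xi, form_curvature_lift hA hD hDbar hX hY hZ]
  · rw [gbar_xi, form_curvature_xi hA hD hDbar hX hY]
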